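/- **Setting.** The network is a finite connected graph $G=(V,E)$ of diameter $D$, in the local shared memory model with a distributed weakly fair daemon: in each step the daemon chooses some processors, and each chosen processor executes an enabled action (guards are evaluated in the configuration before the step). A processor is neutralized in a step if it is enabled before it, does not act in it, and is not enabled after it. The first round of an execution is its minimal prefix during which every processor enabled at the beginning acts or is neutralized; the next round is the first round of the remaining suffix, and so on. Routing tables are computed by a self-stabilizing silent algorithm $\mathcal A$, which has priority and stabilizes in $R_{\mathcal A}$ rounds: from any configuration, after $R_{\mathcal A}$ rounds no action of $\mathcal A$ is enabled and, for all $p\ne d$, $nextHop_p(d)$ is a neighbor of $p$ at distance $dist(p,d)-1$ from $d$. At all times $nextHop_p(d)$ is some neighbor of $p$. **Protocol $\mathcal{SSMFP}_2$.** Processor $p$ has buffers $buf_p(1),\dots,buf_p(D+1)$, each empty ($\varepsilon$) or holding a message $(m,r,q,d,c)$: information, next processor, last processor, destination, type $c\in\{S,A,F\}$. For $i\ge2$, $choice_p(i)$ is a neighbor $s$ of $p$ such that $buf_s(i-1)=(m,p,q,d,S)$ with $d\neq s$, if there is one. Below, a pattern preceded by $\ne$ means that no value of its free letters matches. When a rule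 of $p$ applies to $buf_p(i)=(m,r,q,d,c)$, call *child* a message $(m,\cdot,p,d,\cdot)$ in $buf_r(i+1)$ and *parent* a message $(m,p,\cdot,d,\cdot)$ in $buf_q(i-1)$. Rules of $p$: * $R_1$: if $p$ has a request to send $m$ to $d$, $buf_p(1)=\varepsilon$ and $buf_{nextHop_p(d)}(2)\ne(m,r',p,d,c)$, then $buf_p(1):=(m,nextHop_p(d),r,d,S)$ with $r$ a neighbor of $p$, and the request is consumed (the message is generated). * $R_2,R_3$ ($i=1$, $d\ne p$): if $c=F$ and there is no child of type $F$, then $buf_p(1):=(m,nextHop_p(d),q,d,S)$; if $c=A$ and there is no child of type $A$, erase. * $R_4,R_5,R_6$ ($i=1$, $d=p$): if $c=S$, deliver $m$ and set the type to $A$; if $c=A$, erase; if $c=F$, set the type to $S$. * $R_7$ ($1\le i\le D$): if $c=S$, $p\neq d$ and there is a child of type $c'\in\{F,A\}$, set the type to $c'$. * $R_8$ ($2\le i\le D$): if $buf_p(i)=\varepsilon$, $choice_p(i)=s$, $buf_s(i-1)=(m,p,q,d,S)$ and $buf_{nextHop_p(d)}(i+1)\ne(m,r,p,d,c)$, then $buf_p(i):=(m,nextHop_p(d),s,d,S)$.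 $R_{12}$: the same for $i=D+1$, without the last condition. * $R_{10}$ ($2\le i\le D+1$): if $c=S$ and $d=p$, deliver $m$ and set the type to $A$. $R_{13}$ ($i=D+1$): if $c=S$ and $d\ne p$, set the type to $F$. * $R_9,R_{11},R_{14}$ ($i\ge2$, $c\in\{F,A\}$): erase if there is a parent of type $c$ and either $d=p$, or $i=D+1$, or there is no child of type $c$. * $R_{15}$–$R_{18}$ ($i\ge2$, $c\in\{F,A\}$, and no child of type $c$ if $i\le D$): erase if there is no parent, or if there is a parent whose type is the element of $\{F,A\}\setminus\{c\}$, or if there is a parent and $q=d$. There are no invalid messages if all buffers are empty in the initial configuration (routing tables may be arbitrary). The amortized complexity of an execution is its number of rounds divided by its number of delivered messages (for an infinite execution: the limit superior of this ratio over its prefixes). A caterpillar of type $S$ is a maximal sequence of buffers $buf_{p_1}(i),\dots,buf_{p_t}(i+t-1)$ holding copies of one message of destination $d$, each linked to the following one by the next/last fields, with $p_j\ne d$ and $p_{j+1}\neq p_j$ for $j<t$, and with types $S\cdots S A\cdots A$ or $S\cdots SF\cdots F$, in which in fact all types are $S$. **Proposition.** 1. There is a universal constant $C$ such that, for every network, every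 such $\mathcal A$, and every execution of $\mathcal{SSMFP}_2$ without invalid messages in which at least one message is generated, the amortized complexity is at most $C\max(R_{\mathcal A},D)$ rounds. 2. Suppose moreover that the routing tables are correct (and $\mathcal A$ has converged) in the initial configuration, and that each chosen processor executes simultaneously one rule on each of its buffers on which a rule is enabled. Then, for every configuration $\gamma$ of the execution which contains a caterpillar of type $S$, at least one message is delivered in the $3D+1$ rounds following $\gamma$. -/

import Mathlib

open scoped ENNReal

universe u v w

namespace SSMFP

/-! ### Rounds

`en t p`: processor `p` is enabled in the `t`-th configuration.
`ac t p`: processor `p` executes an action in the step from configuration `t` to `t + 1`. -/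

section Rounds

variable {V : Type u}

/-- During the steps `t, …, t' - 1`, processor `p` executes an action or is neutralized
(enabled before a step in which it does not act, and not enabled after it). -/
def ActsOrNeutralized (en ac : ℕ → V → Prop) (t t' : ℕ) (p : V) : Prop :=
  ∃ s, t ≤ s ∧ s < t' ∧ (ac s p ∨ (en s p ∧ ¬ en (s + 1) p))

/-- The end of the round which starts at time `t`: the least later time by which every processor
enabled at time `t` has acted or has been neutralized. -/
noncomputable def roundEnd (en ac : ℕ → V → Prop) (t : ℕ) : ℕ :=
  sInf {t' | t < t' ∧ ∀ p, en t p → ActsOrNeutralized en ac t t' p}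

/-- The end of the `k`-th round of the suffix which starts at time `t`. -/
noncomputable def roundBoundary (en ac : ℕ → V → Prop) (t : ℕ) : ℕ → ℕ
  | 0 => t
  | k + 1 => roundEnd en ac (roundBoundary en ac t k)

open Classical in
/-- The number of rounds completed by time `T`. Since sequences of configurations are infinite
here (a terminal configuration is repeated), a unit of time that starts with no processor
enabled is not a round and is not counted. -/
noncomputable def roundCount (en ac : ℕ → V → Prop) (T : ℕ) : ℕ :=
  ((Finset.range T).filter fun k =>
    roundBoundary en ac 0 (k + 1) ≤ T ∧ ∃ p, en (roundBoundary en ac 0 k) p).card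

/-- Weakly fair daemon: a continuously enabled processor is eventually chosen. -/
def WeaklyFair (en ac : ℕ → V → Prop) : Prop :=
  ∀ p t, (∀ s, t ≤ s → en s p) → ∃ s, t ≤ s ∧ ac s p

end Rounds

/-! ### The routing algorithm -/

/-- A distributed algorithm in the local shared memory model which maintains routing tables on the
network `G`. `act p σ s` : in configuration `σ`, processor `p` has an enabled action which
changes its state to `s`. `nextHop p s d` is the entry for destination `d` of the table held by `p`
in state `s`; it is always a neighbor of `p` (an arbitrary one if `d = p`). -/
structure RoutingAlgorithm {V : Type u} (G : SimpleGraph V) where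
  State : Type w
  act : V → (V → State) → State → Prop
  act_local : ∀ p σ τ, (∀ q, q = p ∨ G.Adj p q → σ q = τ q) → ∀ s, act p σ s ↔ act p τ s
  nextHop : V → State → V → V
  nextHop_adj : ∀ p s d, G.Adj p (nextHop p s d)

namespace RoutingAlgorithm

variable {V : Type u} {G : SimpleGraph V} (A : RoutingAlgorithm.{u, w} G)

def Enabled (σ : V → A.State) (p : V) : Prop := ∃ s, A.act p σ s

/-- The routing tables induce paths with a minimal number of edges. -/
def TablesCorrect (σ : V → A.State) : Prop :=
  ∀ p d, p ≠ d → G.dist (A.nextHop p (σ p) d) d + 1 = G.dist p d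

/-- Tables are correct, and no action of the (silent) algorithm is enabled any more. -/
def Converged (σ : V → A.State) : Prop :=
  A.TablesCorrect σ ∧ ∀ p, ¬ A.Enabled σ p

/-- `σ` is a sequence of configurations of `A` running alone, `ac t` being the set of processors
that act in step `t`. (A step in which no processor acts is a pause; pauses do not change the number
of rounds, and weak fairness prevents pausing forever while a processor is enabled.) -/
structure IsExecution (σ : ℕ → V → A.State) (ac : ℕ → V → Prop) : Prop where
  step_act : ∀ t p, ac t p → A.act p (σ t) (σ (t + 1) p)
  step_idle : ∀ t p, ¬ ac t p → σ (t + 1) p = σ t p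
  fair : WeaklyFair (fun t => A.Enabled (σ t)) ac

/-- From every initial configuration, and under every weakly fair daemon, `A` has converged after
`R` rounds. -/
def StabilizesWithin (R : ℕ) : Prop :=
  ∀ σ ac, A.IsExecution σ ac →
    A.Converged (σ (roundBoundary (fun t => A.Enabled (σ t)) ac 0 R))

/-- `A` is self-stabilizing and silent with stabilization time `R` (in rounds). -/
def IsStabilizationTime (R : ℕ) : Prop := IsLeast {R | A.StabilizesWithin R} R

end RoutingAlgorithm

/-! ### The forwarding protocol -/

/-- Types of messages: sending, acknowledgment, fail. -/
inductive MsgType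
  | S | A | F

/-- The message `(m, r, q, d, c)`: useful information, next processor, last processor, destination,
type. -/
structure Msg (V : Type u) (M : Type v) where
  info : M
  next : V
  last : V
  dest : V
  type : MsgType

/-- A configuration. `buf p i` is the buffer of rank `i` of processor `p` (`none` if it is empty);
only ranks `1, …, D + 1` are used. `req p = some (m, d)` means that `request_p` is true and that
the higher layer of `p` waits for sending `m` to `d`. -/
structure Config {V : Type u} {G : SimpleGraph V} (A : RoutingAlgorithm.{u, w} G) (M : Type v) where
  table : V → A.State
  buf : V → ℕ → Option (Msg V M)
  req : V → Option (M × V)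

/-- What a rule does besides writing in a buffer: `R1` consumes the request, `R4` and `R10` deliver
a message to the higher layer. -/
inductive Effect
  | generate | deliver | internal

section Protocol

variable {V : Type u} {M : Type v} {G : SimpleGraph V} {A : RoutingAlgorithm.{u, w} G}

/-- `nextHop_p(d)` in the configuration `γ`. -/
def Config.hop (γ : Config A M) (p d : V) : V := A.nextHop p (γ.table p) d

/-- `s` can send a message in `buf_p(i)`. -/
def Candidate (γ : Config A M) (p : V) (i : ℕ) (s : V) : Prop :=
  G.Adj p s ∧ ∃ m q d, γ.buf s (i - 1) = some ⟨m, p, q, d, .S⟩ ∧ s ≠ d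

/-- `ch p i` is a legal value of `choice_p(i)`, for every `p` and `2 ≤ i ≤ D + 1`: a processor
which can send a message in `buf_p(i)`, if there is one. -/
def ValidChoice (γ : Config A M) (ch : V → ℕ → Option V) : Prop :=
  ∀ p i, 2 ≤ i → i ≤ G.diam + 1 →
    (∀ s, ch p i = some s → Candidate γ p i s) ∧ (ch p i = none → ∀ s, ¬ Candidate γ p i s)

/-- `Fires γ ch p i b e`: in the configuration `γ`, with the values `ch` of the procedure
`choice`, processor `p` has an enabled rule which writes `b` in its buffer of rank `i`
and has effect `e`. One constructor for each rule of the protocol. -/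
inductive Fires (γ : Config A M) (ch : V → ℕ → Option V) (p : V) :
    ℕ → Option (Msg V M) → Effect → Prop
  /-- Generation of a message. -/
  | R1 (m : M) (d r : V) :
      γ.req p = some (m, d) → γ.buf p 1 = none →
      (¬ ∃ r' c, γ.buf (γ.hop p d) 2 = some ⟨m, r', p, d, c⟩) → G.Adj p r →
      Fires γ ch p 1 (some ⟨m, γ.hop p d, r, d, .S⟩) .generate
  /-- Rank 1, processing of acknowledgments. -/
  | R2 (m : M) (r q d : V) :
      γ.buf p 1 = some ⟨m, r, q, d, .F⟩ → d ≠ p →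
      (¬ ∃ r', γ.buf r 2 = some ⟨m, r', p, d, .F⟩) →
      Fires γ ch p 1 (some ⟨m, γ.hop p d, q, d, .S⟩) .internal
  | R3 (m : M) (r q d : V) :
      γ.buf p 1 = some ⟨m, r, q, d, .A⟩ → d ≠ p →
      (¬ ∃ r', γ.buf r 2 = some ⟨m, r', p, d, .A⟩) →
      Fires γ ch p 1 none .internal
  /-- Rank 1, messages which reach their destination. -/
  | R4 (m : M) (r q : V) :
      γ.buf p 1 = some ⟨m, r, q, p, .S⟩ →
      Fires γ ch p 1 (some ⟨m, r, q, p, .A⟩) .deliver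
  | R5 (m : M) (r q : V) :
      γ.buf p 1 = some ⟨m, r, q, p, .A⟩ →
      Fires γ ch p 1 none .internal
  | R6 (m : M) (r q : V) :
      γ.buf p 1 = some ⟨m, r, q, p, .F⟩ →
      Fires γ ch p 1 (some ⟨m, r, q, p, .S⟩) .internal
  /-- Propagation of acknowledgments. -/
  | R7 (i : ℕ) (m : M) (r q d r' : V) (c : MsgType) :
      1 ≤ i → i ≤ G.diam → γ.buf p i = some ⟨m, r, q, d, .S⟩ → p ≠ d →
      γ.buf r (i + 1) = some ⟨m, r', p, d, c⟩ → c ≠ .S →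
      Fires γ ch p i (some ⟨m, r, q, d, c⟩) .internal
  /-- Forwarding. -/
  | R8 (i : ℕ) (m : M) (s q d : V) :
      2 ≤ i → i ≤ G.diam → γ.buf p i = none → ch p i = some s →
      γ.buf s (i - 1) = some ⟨m, p, q, d, .S⟩ →
      (¬ ∃ r c, γ.buf (γ.hop p d) (i + 1) = some ⟨m, r, p, d, c⟩) →
      Fires γ ch p i (some ⟨m, γ.hop p d, s, d, .S⟩) .internal
  /-- Erasing after the acknowledgment has been forwarded. -/
  | R9 (i : ℕ) (m : M) (r q d q' : V) (c : MsgType) :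
      2 ≤ i → i ≤ G.diam → γ.buf p i = some ⟨m, r, q, d, c⟩ → c ≠ .S → d ≠ p →
      γ.buf q (i - 1) = some ⟨m, p, q', d, c⟩ →
      (¬ ∃ r', γ.buf r (i + 1) = some ⟨m, r', p, d, c⟩) →
      Fires γ ch p i none .internal
  /-- Consumption. -/
  | R10 (i : ℕ) (m : M) (r q : V) :
      2 ≤ i → i ≤ G.diam + 1 → γ.buf p i = some ⟨m, r, q, p, .S⟩ →
      Fires γ ch p i (some ⟨m, r, q, p, .A⟩) .deliver
  /-- Erasing at the destination. -/
  | R11 (i : ℕ) (m : M) (r q q' : V) (c : MsgType) :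
      2 ≤ i → i ≤ G.diam + 1 → γ.buf p i = some ⟨m, r, q, p, c⟩ → c ≠ .S →
      γ.buf q (i - 1) = some ⟨m, p, q', p, c⟩ →
      Fires γ ch p i none .internal
  /-- Rank `D + 1`: forwarding, generation of the acknowledgment `F`, erasing. -/
  | R12 (m : M) (s q d : V) :
      γ.buf p (G.diam + 1) = none → ch p (G.diam + 1) = some s →
      γ.buf s G.diam = some ⟨m, p, q, d, .S⟩ →
      Fires γ ch p (G.diam + 1) (some ⟨m, γ.hop p d, s, d, .S⟩) .internal
  | R13 (m : M) (r q d : V) :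
      γ.buf p (G.diam + 1) = some ⟨m, r, q, d, .S⟩ → d ≠ p →
      Fires γ ch p (G.diam + 1) (some ⟨m, r, q, d, .F⟩) .internal
  | R14 (m : M) (r q d q' : V) (c : MsgType) :
      γ.buf p (G.diam + 1) = some ⟨m, r, q, d, c⟩ → c ≠ .S → d ≠ p →
      γ.buf q G.diam = some ⟨m, p, q', d, c⟩ →
      Fires γ ch p (G.diam + 1) none .internal
  /-- Correction rules. -/
  | R15 (i : ℕ) (m : M) (r q d : V) (c : MsgType) :
      2 ≤ i → i ≤ G.diam → γ.buf p i = some ⟨m, r, q, d, c⟩ → c ≠ .S →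
      (¬ ∃ r', γ.buf r (i + 1) = some ⟨m, r', p, d, c⟩) →
      (¬ ∃ q' c', γ.buf q (i - 1) = some ⟨m, p, q', d, c'⟩) →
      Fires γ ch p i none .internal
  | R16 (i : ℕ) (m : M) (r q d q' : V) (c c' : MsgType) :
      2 ≤ i → i ≤ G.diam → γ.buf p i = some ⟨m, r, q, d, c⟩ → c ≠ .S →
      (¬ ∃ r', γ.buf r (i + 1) = some ⟨m, r', p, d, c⟩) →
      γ.buf q (i - 1) = some ⟨m, p, q', d, c'⟩ → ((c' ≠ .S ∧ c' ≠ c) ∨ q = d) →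
      Fires γ ch p i none .internal
  | R17 (m : M) (r q d : V) (c : MsgType) :
      γ.buf p (G.diam + 1) = some ⟨m, r, q, d, c⟩ → c ≠ .S →
      (¬ ∃ q' c', γ.buf q G.diam = some ⟨m, p, q', d, c'⟩) →
      Fires γ ch p (G.diam + 1) none .internal
  | R18 (m : M) (r q d q' : V) (c c' : MsgType) :
      γ.buf p (G.diam + 1) = some ⟨m, r, q, d, c⟩ → c ≠ .S →
      γ.buf q G.diam = some ⟨m, p, q', d, c'⟩ → ((c' ≠ .S ∧ c' ≠ c) ∨ q = d) →
      Fires γ ch p (G.diam + 1) none .internal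

/-- No message in the network: all buffers are empty. -/
def NoMessage (γ : Config A M) : Prop :=
  ∀ p i, 1 ≤ i → i ≤ G.diam + 1 → γ.buf p i = none

/-! ### Caterpillars -/

/-- The buffers `buf_{p 0}(i), …, buf_{p (t-1)}(i+t-1)` contain linked copies, of types
`c 0, …, c (t-1)`, of a message with useful information `m` and destination `d`. -/
def IsChain (γ : Config A M) (m : M) (d : V) (i t : ℕ) (p : ℕ → V) (c : ℕ → MsgType) : Prop :=
  1 ≤ i ∧ 1 ≤ t ∧ i + t ≤ G.diam + 2 ∧
  (∀ j, j + 1 < t → p j ≠ d ∧ p (j + 1) ≠ p j) ∧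
  (∀ j, j < t → ∃ r q, γ.buf (p j) (i + j) = some ⟨m, r, q, d, c j⟩ ∧
    (j + 1 < t → r = p (j + 1)) ∧ (1 ≤ j → q = p (j - 1))) ∧
  ∃ k, k ≤ t ∧ (∀ j, j < k → c j = .S) ∧
    ((∀ j, k ≤ j → j < t → c j = .A) ∨ (∀ j, k ≤ j → j < t → c j = .F))

/-- A caterpillar: a chain which is not a proper part of another one. -/
def IsCaterpillar (γ : Config A M) (m : M) (d : V) (i t : ℕ) (p : ℕ → V) (c : ℕ → MsgType) :
    Prop :=
  IsChain γ m d i t p c ∧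
  ∀ i' t' p' c', IsChain γ m d i' t' p' c' → i' ≤ i → i + t ≤ i' + t' →
    (∀ j, j < t → p' (i - i' + j) = p j) → t' = t

/-- The configuration contains a caterpillar of type `S`. -/
def HasSCaterpillar (γ : Config A M) : Prop :=
  ∃ m d i t p c, IsCaterpillar γ m d i t p c ∧ ∀ j, j < t → c j = .S

end Protocol

/-! ### Executions -/

/-- An execution of the protocol composed with the routing algorithm `A`, which has priority.
* `conf t` is the `t`-th configuration and `choice t` the value of the procedure `choice` in it;
* `routed t p`: processor `p` executes an action of `A` in step `t`;
* `fired t p i = some e`: in step `t`, processor `p` executes a rule, of effect `e`, on its buffer of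
  rank `i`.

All the guards of a step are evaluated in `conf t`. A processor chosen by the daemon may execute just
one of its enabled rules, or several ones on different buffers; which ones is arbitrary.
Between two configurations, the higher layer of a processor without outstanding request may set one.
Steps in which no processor acts are allowed: in this way a finite maximal execution repeats
its terminal configuration, and the higher layer may submit requests to an idle network. -/
structure Execution {V : Type u} {G : SimpleGraph V} (A : RoutingAlgorithm.{u, w} G)
    (M : Type v) where
  conf : ℕ → Config A M
  choice : ℕ → V → ℕ → Option V
  routed : ℕ → V → Prop
  fired : ℕ → V → ℕ → Option Effect
  choice_valid : ∀ t, ValidChoice (conf t) (choice t)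
  routed_act : ∀ t p, routed t p → A.act p (conf t).table ((conf (t + 1)).table p)
  routed_idle : ∀ t p, ¬ routed t p → (conf (t + 1)).table p = (conf t).table p
  priority : ∀ t p i, A.Enabled (conf t).table p → fired t p i = none
  fired_rule : ∀ t p i e, fired t p i = some e →
    Fires (conf t) (choice t) p i ((conf (t + 1)).buf p i) e
  fired_idle : ∀ t p i, fired t p i = none → (conf (t + 1)).buf p i = (conf t).buf p i
  req_step : ∀ t p, fired t p 1 ≠ some .generate →
    (conf (t + 1)).req p = (conf t).req p ∨ (conf t).req p = none

namespace Execution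

variable {V : Type u} {M : Type v} {G : SimpleGraph V} {A : RoutingAlgorithm.{u, w} G}
  (Γ : Execution A M)

/-- Processor `p` is enabled at time `t`, by the routing algorithm or by the protocol. -/
def Enabled (t : ℕ) (p : V) : Prop :=
  A.Enabled (Γ.conf t).table p ∨ ∃ i b e, Fires (Γ.conf t) (Γ.choice t) p i b e

/-- Processor `p` executes some action in step `t`. -/
def Acts (t : ℕ) (p : V) : Prop := Γ.routed t p ∨ ∃ i, Γ.fired t p i ≠ none

/-- The daemon is weakly fair. -/
def Fair : Prop := WeaklyFair Γ.Enabled Γ.Acts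

/-- Every chosen processor which runs the protocol executes simultaneously a rule on each of its
buffers on which some rule is enabled. -/
def Simultaneous : Prop :=
  ∀ t p, Γ.Acts t p → ¬ A.Enabled (Γ.conf t).table p →
    ∀ i, (∃ b e, Fires (Γ.conf t) (Γ.choice t) p i b e) → Γ.fired t p i ≠ none

/-- Some message is generated. -/
def GeneratesSome : Prop := ∃ t p i, Γ.fired t p i = some .generate

/-- Some message is delivered in step `t`. -/
def DeliversAt (t : ℕ) : Prop := ∃ p i, Γ.fired t p i = some .deliver

open Classical in
/-- The number of messages delivered in the first `T` steps. -/
noncomputable def delivered [Fintype V] (T : ℕ) : ℕ :=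
  ∑ t ∈ Finset.range T, ∑ p : V, ∑ i ∈ Finset.Icc 1 (G.diam + 1),
    if Γ.fired t p i = some .deliver then 1 else 0

/-- The number of rounds completed in the first `T` steps. -/
noncomputable def rounds (T : ℕ) : ℕ := roundCount Γ.Enabled Γ.Acts T

/-- The number of rounds divided by the number of delivered messages. On a finite execution (one
which ends by repeating a terminal configuration) the ratio is eventually constant, and its limit
superior is the ratio of the total numbers. -/
noncomputable def amortizedComplexity [Fintype V] : ℝ≥0∞ :=
  Filter.limsup (fun T => (Γ.rounds T : ℝ≥0∞) / (Γ.delivered T : ℝ≥0∞)) Filter.atTop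

end Execution

end SSMFP

/-! Both parts rest on one invariant (`Linked`), which holds in every configuration reached from
empty buffers: each copy of rank at least 2 has a parent one rank below, whose type is `S` or its
own. Copies thus form chains rooted at rank 1, correction rules never apply, and copies or
acknowledgments of adjacent ranks can be matched injectively.

Amortized bound. Once the routing algorithm has converged, a round that starts with an enabled
processor contains a step where a forwarding rule is executed, so rounds are bounded by R plus the
number of such active steps. Each content of a buffer undergoes at most three rules (arrival, change
of type, erasure), and copies of rank i + 1 are charged to distinct copies of rank i; so the active
steps number at most 3(D + 1) times the messages present or emitted at rank 1. A message emitted on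
correct tables loses one unit of distance per rank and reaches its destination by rank D + 1, so it
never fails (`onTrack_of_not_stale`). Hence each message present at convergence is re-emitted at
most once thereafter, and the active steps are at most 6(D + 1) times the generated messages.
Finally, an acknowledgment at rank 1 descends from a delivery of its own, so generated messages
exceed deliveries by at most the number n of roots still pending. After more than n deliveries this
excess is absorbed by a factor 2; otherwise generation is bounded, activity stops, the network is
empty, and there is no excess.

Progress. With correct tables only the types `S` and `A` occur. Suppose no delivery takes place.
Each round lowers the highest possible rank of an acknowledgment (`ack_rank_le`), so after D + 1
rounds none is left above rank 1. From then on, the last buffer of an `S` chain either sends into an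
empty buffer or faces an `S` message belonging to a chain that ends higher, so each round produces a
chain end of larger rank (`exists_head_roundEnd`). After D + 1 more rounds the rank would exceed D +
1. Since D ≥ 1, 2D + 2 ≤ 3D + 1. -/

namespace SSMFP

/-! ### Comparing rounds, and bounding their number by active steps -/

section RoundLemmas

variable {V : Type u} {en ac : ℕ → V → Prop}

theorem ActsOrNeutralized.mono {t₁ t₂ t₁' t₂' : ℕ} {p : V}
    (h : ActsOrNeutralized en ac t₁ t₁' p) (h₁ : t₂ ≤ t₁) (h₂ : t₁' ≤ t₂') :
    ActsOrNeutralized en ac t₂ t₂' p := by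
  obtain ⟨s, hs, hs', h⟩ := h
  exact ⟨s, h₁.trans hs, hs'.trans_le h₂, h⟩

theorem exists_disabling {t t' : ℕ} {p : V} (htt' : t ≤ t') (h : en t p) (h' : ¬ en t' p) :
    ∃ s, t ≤ s ∧ s < t' ∧ en s p ∧ ¬ en (s + 1) p := by
  induction t', htt' using Nat.le_induction with
  | base => exact absurd h h'
  | succ n hn ih =>
    by_cases hp : en n p
    · exact ⟨n, hn, n.lt_succ_self, hp, h'⟩
    · obtain ⟨s, h₁, h₂, h₃⟩ := ih hp
      exact ⟨s, h₁, h₂.trans n.lt_succ_self, h₃⟩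

theorem exists_actsOrNeutralized (hf : WeaklyFair en ac) {t : ℕ} {p : V} (h : en t p) :
    ∃ t', ActsOrNeutralized en ac t t' p := by
  by_cases hall : ∀ s, t ≤ s → en s p
  · obtain ⟨s, hs, ha⟩ := hf p t hall
    exact ⟨s + 1, s, hs, s.lt_succ_self, Or.inl ha⟩
  · push Not at hall
    obtain ⟨t', ht', hn⟩ := hall
    obtain ⟨s, h₁, h₂, h₃⟩ := exists_disabling ht' h hn
    exact ⟨t', s, h₁, h₂, Or.inr h₃⟩

theorem exists_roundEnd [Finite V] (hf : WeaklyFair en ac) (t : ℕ) :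
    ∃ t', t < t' ∧ ∀ p, en t p → ActsOrNeutralized en ac t t' p := by
  have : ∀ p, ∃ t', en t p → ActsOrNeutralized en ac t t' p := fun p => by
    by_cases h : en t p
    · exact (exists_actsOrNeutralized hf h).imp fun _ h _ => h
    · exact ⟨0, fun h' => absurd h' h⟩
  choose f hf using this
  obtain ⟨b, hb⟩ := (Set.finite_range f).bddAbove
  refine ⟨max b t + 1, by omega, fun p hp => (hf p hp).mono le_rfl ?_⟩
  have := hb ⟨p, rfl⟩
  omega

theorem roundEnd_spec [Finite V] (hf : WeaklyFair en ac) (t : ℕ) :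
    t < roundEnd en ac t ∧ ∀ p, en t p → ActsOrNeutralized en ac t (roundEnd en ac t) p :=
  Nat.sInf_mem (s := {t' | t < t' ∧ ∀ p, en t p → ActsOrNeutralized en ac t t' p})
    (exists_roundEnd hf t)

theorem roundEnd_le {t t' : ℕ} (h : t < t') (h' : ∀ p, en t p → ActsOrNeutralized en ac t t' p) :
    roundEnd en ac t ≤ t' :=
  Nat.sInf_le ⟨h, h'⟩

/-- A processor enabled at the earlier start either is still enabled at the later one or was
disabled in between, which already settles it for the earlier round. -/
theorem roundEnd_mono [Finite V] (hf : WeaklyFair en ac) {t₁ t₂ : ℕ} (h : t₁ ≤ t₂) :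
    roundEnd en ac t₁ ≤ roundEnd en ac t₂ := by
  obtain ⟨h₁, h₂⟩ := roundEnd_spec hf t₂
  refine roundEnd_le (h.trans_lt h₁) fun p hp => ?_
  by_cases hp' : en t₂ p
  · exact (h₂ p hp').mono h le_rfl
  · obtain ⟨s, hs, hs', hn⟩ := exists_disabling h hp hp'
    exact ⟨s, hs, hs'.trans h₁, Or.inr hn⟩

theorem roundBoundary_strictMono [Finite V] (hf : WeaklyFair en ac) (t : ℕ) :
    StrictMono (roundBoundary en ac t) :=
  strictMono_nat_of_lt_succ fun _ => (roundEnd_spec hf _).1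

/-- Rounds of an algorithm which has priority are not longer than those of the composition. -/
theorem roundBoundary_le_of_priority [Finite V] {en' ac' : ℕ → V → Prop}
    (hf : WeaklyFair en ac) (hf' : WeaklyFair en' ac') (hen : ∀ t p, en' t p → en t p)
    (hac : ∀ t p, en' t p → ac t p → ac' t p) (t k : ℕ) :
    roundBoundary en' ac' t k ≤ roundBoundary en ac t k := by
  induction k with
  | zero => exact le_rfl
  | succ k ih =>
    refine (roundEnd_mono hf' ih).trans ?_
    obtain ⟨h₁, h₂⟩ := roundEnd_spec hf (roundBoundary en ac t k)
    refine roundEnd_le h₁ fun p hp => ?_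
    obtain ⟨s, hs, hs', h⟩ := h₂ p (hen _ _ hp)
    -- If the priority algorithm no longer enables `p` at the step that settles it, an earlier step
    -- disabled it, and that step settles it for the shorter round.
    by_cases hps : en' s p
    · rcases h with h | ⟨_, h⟩
      · exact ⟨s, hs, hs', Or.inl (hac _ _ hps h)⟩
      · exact ⟨s, hs, hs', Or.inr ⟨hps, fun h' => h (hen _ _ h')⟩⟩
    · obtain ⟨s', h₃, h₄, h₅⟩ := exists_disabling hs hp hps
      exact ⟨s', h₃, h₄.trans hs', Or.inr h₅⟩

/-- If, from the end of the `R`-th round on, a round that starts with an enabled processor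
contains an active step, then the number of rounds is bounded by the number of active steps. -/
theorem roundCount_le [Finite V] (hf : WeaklyFair en ac) (R : ℕ) (active : ℕ → Prop)
    [DecidablePred active]
    (h : ∀ t, roundBoundary en ac 0 R ≤ t → (∃ p, en t p) →
      ∃ s, t ≤ s ∧ s < roundEnd en ac t ∧ active s) (T : ℕ) :
    roundCount en ac T ≤
      R + ((Finset.Ico (roundBoundary en ac 0 R) T).filter active).card := by
  classical
  set b := roundBoundary en ac 0 with hb
  have hmono := roundBoundary_strictMono hf 0
  unfold roundCount
  conv_rhs => enter [1]; rw [← Finset.card_range R]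
  refine (Finset.card_le_card (t := Finset.range R ∪ ((Finset.range T).filter fun k =>
    R ≤ k ∧ b (k + 1) ≤ T ∧ ∃ p, en (b k) p)) fun k hk => ?_).trans
    ((Finset.card_union_le _ _).trans (Nat.add_le_add_left ?_ _))
  · simp only [Finset.mem_filter, Finset.mem_range, Finset.mem_union] at hk ⊢
    by_cases hkR : k < R
    · exact Or.inl hkR
    · exact Or.inr ⟨hk.1, not_lt.1 hkR, hk.2⟩
  -- One active step is picked in each counted round; rounds are disjoint time intervals, so the
  -- choice is injective.
  · have hex : ∀ k, ∃ s, (R ≤ k ∧ ∃ p, en (b k) p) → b k ≤ s ∧ s < b (k + 1) ∧ active s := by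
      intro k
      by_cases hk : R ≤ k ∧ ∃ p, en (b k) p
      · obtain ⟨s, hs⟩ := h (b k) (hmono.monotone hk.1) hk.2
        exact ⟨s, fun _ => hs⟩
      · exact ⟨0, fun h' => absurd h' hk⟩
    choose f hfs using hex
    refine Finset.card_le_card_of_injOn f (fun k hk => ?_) fun k hk l hl hkl => ?_
    · simp only [Finset.coe_filter, Finset.mem_range, Set.mem_ofPred_eq] at hk
      obtain ⟨h₁, h₂, h₃⟩ := hfs k ⟨hk.2.1, hk.2.2.2⟩
      have := hmono.monotone hk.2.1
      simp only [Finset.coe_filter, Finset.mem_Ico, Set.mem_ofPred_eq]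
      exact ⟨⟨this.trans h₁, h₂.trans_le hk.2.2.1⟩, h₃⟩
    · simp only [Finset.coe_filter, Finset.mem_range, Set.mem_ofPred_eq] at hk hl
      obtain ⟨h₁, h₂, -⟩ := hfs k ⟨hk.2.1, hk.2.2.2⟩
      obtain ⟨h₃, h₄, -⟩ := hfs l ⟨hl.2.1, hl.2.2.2⟩
      by_contra hne
      rcases Nat.lt_or_gt_of_ne hne with hlt | hlt
      · have : b (k + 1) ≤ b l := hmono.monotone hlt
        omega
      · have : b (l + 1) ≤ b k := hmono.monotone hlt
        omega

end RoundLemmas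

/-! ### The invariant: every copy has a compatible parent -/

section Links

variable {V : Type u} {M : Type v} {G : SimpleGraph V} {A : RoutingAlgorithm.{u, w} G}

/-- Every message of rank at least `2` is linked to a message of the previous rank, which does not
have another acknowledgment type and is not at its destination. -/
structure Linked (γ : Config A M) : Prop where
  adj : ∀ {p i m r q d c}, 1 ≤ i → i ≤ G.diam + 1 → γ.buf p i = some ⟨m, r, q, d, c⟩ → G.Adj p r
  parent : ∀ {p i m r q d c}, 1 ≤ i → i ≤ G.diam → γ.buf p (i + 1) = some ⟨m, r, q, d, c⟩ →
    q ≠ d ∧ ∃ q' c', γ.buf q i = some ⟨m, p, q', d, c'⟩ ∧ (c' = .S ∨ c' = c)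

/-- The effect of the rules on a buffer in a linked configuration. -/
inductive BufStep (γ : Config A M) (p : V) (i : ℕ) (b' : Option (Msg V M)) (e : Effect) : Prop
  | generate (m : M) (d r : V) : e = .generate → i = 1 → γ.buf p i = none →
      b' = some ⟨m, γ.hop p d, r, d, .S⟩ → BufStep γ p i b' e
  | reemit (m : M) (r q d r' : V) : e = .internal → i = 1 → γ.buf p i = some ⟨m, r, q, d, .F⟩ →
      ((d = p ∧ r' = r) ∨
        (d ≠ p ∧ r' = γ.hop p d ∧ ¬ ∃ x, γ.buf r (i + 1) = some ⟨m, x, p, d, .F⟩)) →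
      b' = some ⟨m, r', q, d, .S⟩ → BufStep γ p i b' e
  | forward (j : ℕ) (m : M) (s q d : V) : e = .internal → i = j + 1 → 1 ≤ j → j ≤ G.diam →
      γ.buf p i = none → G.Adj p s → s ≠ d → γ.buf s j = some ⟨m, p, q, d, .S⟩ →
      b' = some ⟨m, γ.hop p d, s, d, .S⟩ → BufStep γ p i b' e
  | deliver (m : M) (r q : V) : e = .deliver → γ.buf p i = some ⟨m, r, q, p, .S⟩ →
      b' = some ⟨m, r, q, p, .A⟩ → BufStep γ p i b' e
  | propagate (m : M) (r q d r' : V) (c : MsgType) : e = .internal → i ≤ G.diam →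
      γ.buf p i = some ⟨m, r, q, d, .S⟩ → p ≠ d → γ.buf r (i + 1) = some ⟨m, r', p, d, c⟩ →
      c ≠ .S → b' = some ⟨m, r, q, d, c⟩ → BufStep γ p i b' e
  | fail (m : M) (r q d : V) : e = .internal → i = G.diam + 1 →
      γ.buf p i = some ⟨m, r, q, d, .S⟩ → d ≠ p → b' = some ⟨m, r, q, d, .F⟩ → BufStep γ p i b' e
  -- Covers `R3`, `R5`, `R9`, `R11` and `R14`. At rank 1 only `A` is erased, since `F` leads to a
  -- new emission; higher up the parent has already taken the type.
  | erase (m : M) (r q d : V) (c : MsgType) : e = .internal → γ.buf p i = some ⟨m, r, q, d, c⟩ →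
      c ≠ .S → (i = 1 → c = .A) →
      (∀ j, i = j + 1 → 1 ≤ j → ∃ q', γ.buf q j = some ⟨m, p, q', d, c⟩) →
      (d = p ∨ i = G.diam + 1 ∨ ¬ ∃ r', γ.buf r (i + 1) = some ⟨m, r', p, d, c⟩) →
      b' = none → BufStep γ p i b' e

theorem Fires.rank {γ : Config A M} {ch : V → ℕ → Option V} {p : V} {i : ℕ}
    {b : Option (Msg V M)} {e : Effect} (h : Fires γ ch p i b e) : 1 ≤ i ∧ i ≤ G.diam + 1 := by
  cases h <;> omega

/-- The correction rules are not enabled in a linked configuration. -/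
theorem Linked.not_correction {γ : Config A M} (hγ : Linked γ) {p : V} {i : ℕ} {m : M}
    {r q d : V} {c : MsgType} (h1 : 1 ≤ i) (h2 : i ≤ G.diam)
    (hb : γ.buf p (i + 1) = some ⟨m, r, q, d, c⟩)
    (h : (¬ ∃ q' c', γ.buf q i = some ⟨m, p, q', d, c'⟩) ∨
      ∃ q' c', γ.buf q i = some ⟨m, p, q', d, c'⟩ ∧ ((c' ≠ .S ∧ c' ≠ c) ∨ q = d)) : False := by
  obtain ⟨hqd, q', c', hq, hc⟩ := hγ.parent h1 h2 hb
  rcases h with h | ⟨q'', c'', hq', ⟨hS, hc'⟩ | h⟩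
  · exact h ⟨_, _, hq⟩
  · rw [hq] at hq'
    cases hq'
    tauto
  · exact hqd h

theorem Fires.bufStep {γ : Config A M} (hγ : Linked γ) (hD : 1 ≤ G.diam)
    {ch : V → ℕ → Option V} (hch : ValidChoice γ ch) {p : V} {i : ℕ}
    {b' : Option (Msg V M)} {e : Effect} (h : Fires γ ch p i b' e) : BufStep γ p i b' e := by
  -- A legal value of `choice` supplies what the guards of `R8` and `R12` leave implicit: adjacency,
  -- and a sender that is not the destination.
  have hcand : ∀ {s m q d} j, 1 ≤ j → j ≤ G.diam → ch p (j + 1) = some s →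
      γ.buf s j = some ⟨m, p, q, d, .S⟩ → G.Adj p s ∧ s ≠ d := by
    intro s m q d j h1 h2 hs hb
    obtain ⟨hadj, m', q', d', hb', hd⟩ := (hch p (j + 1) (by omega) (by omega)).1 s hs
    rw [Nat.add_sub_cancel, hb] at hb'
    cases hb'
    exact ⟨hadj, hd⟩
  cases h with
  | R1 m d r _ hb _ _ => exact .generate m d r rfl rfl hb rfl
  | R2 m r q d hb hd hn => exact .reemit m r q d _ rfl rfl hb (Or.inr ⟨hd, rfl, hn⟩) rfl
  | R3 m r q d hb hd hn =>
    exact .erase m r q d _ rfl hb nofun (fun _ => rfl) (fun j h h' => by omega)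
      (Or.inr (Or.inr hn)) rfl
  | R4 m r q hb => exact .deliver m r q rfl hb rfl
  | R5 m r q hb =>
    exact .erase m r q _ _ rfl hb nofun (fun _ => rfl) (fun j h h' => by omega) (Or.inl rfl) rfl
  | R6 m r q hb => exact .reemit m r q p r rfl rfl hb (Or.inl ⟨rfl, rfl⟩) rfl
  | R7 _ m r q d r' c h1 h2 hb hp hc hS => exact .propagate m r q d r' c rfl h2 hb hp hc hS rfl
  | R8 _ m s q d h1 h2 hb hs hc _ =>
    obtain ⟨j, rfl⟩ : ∃ j, i = j + 1 := ⟨i - 1, by omega⟩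
    obtain ⟨h3, h4⟩ := hcand j (by omega) (by omega) hs hc
    exact .forward j m s q d rfl rfl (by omega) (by omega) hb h3 h4 hc rfl
  | R9 _ m r q d q' c h1 h2 hb hS hd hq hn =>
    refine .erase m r q d c rfl hb hS (by omega) (fun j hj _ => ⟨q', ?_⟩) (Or.inr (Or.inr hn)) rfl
    subst hj
    exact hq
  | R10 _ m r q h1 h2 hb => exact .deliver m r q rfl hb rfl
  | R11 _ m r q q' c h1 h2 hb hS hq =>
    refine .erase m r q p c rfl hb hS (by omega) (fun j hj _ => ⟨q', ?_⟩) (Or.inl rfl) rfl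
    subst hj
    exact hq
  | R12 m s q d hb hs hc =>
    obtain ⟨h3, h4⟩ := hcand _ hD le_rfl hs hc
    exact .forward _ m s q d rfl rfl hD le_rfl hb h3 h4 hc rfl
  | R13 m r q d hb hd => exact .fail m r q d rfl rfl hb hd rfl
  | R14 m r q d q' c hb hS hd hq =>
    refine .erase m r q d c rfl hb hS (by omega) (fun j hj _ => ⟨q', ?_⟩) (Or.inr (Or.inl rfl)) rfl
    cases hj
    exact hq
  | R15 _ m r q d c h1 h2 hb hS hn hq =>
    obtain ⟨j, rfl⟩ : ∃ j, i = j + 1 := ⟨i - 1, by omega⟩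
    exact (hγ.not_correction (by omega) (by omega) hb (Or.inl hq)).elim
  | R16 _ m r q d q' c c' h1 h2 hb hS hn hq hc =>
    obtain ⟨j, rfl⟩ : ∃ j, i = j + 1 := ⟨i - 1, by omega⟩
    exact (hγ.not_correction (by omega) (by omega) hb (Or.inr ⟨q', c', hq, hc⟩)).elim
  | R17 m r q d c hb hS hq => exact (hγ.not_correction hD le_rfl hb (Or.inl hq)).elim
  | R18 m r q d q' c c' hb hS hq hc =>
    exact (hγ.not_correction hD le_rfl hb (Or.inr ⟨q', c', hq, hc⟩)).elim

/-- In each buffer of the ranks in use, the content is unchanged or a rule has been executed. -/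
def BufTrans (γ γ' : Config A M) : Prop :=
  ∀ p i, 1 ≤ i → i ≤ G.diam + 1 →
    γ'.buf p i = γ.buf p i ∨ ∃ e, BufStep γ p i (γ'.buf p i) e

/-- A message which has a copy at the next rank is not erased, and can only take the type
of this copy. -/
theorem Linked.parent_step {γ γ' : Config A M} (hγ : Linked γ) (ht : BufTrans γ γ')
    {p q : V} {i : ℕ} {m : M} {r q' d : V} {c c' : MsgType} (h1 : 1 ≤ i) (h2 : i ≤ G.diam)
    (hb : γ.buf p (i + 1) = some ⟨m, r, q, d, c⟩) (hq : γ.buf q i = some ⟨m, p, q', d, c'⟩) :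
    γ'.buf q i = some ⟨m, p, q', d, c'⟩ ∨
      (c' = .S ∧ c ≠ .S ∧ γ'.buf q i = some ⟨m, p, q', d, c⟩) := by
  obtain ⟨hqd, q'', c'', hq2, hc⟩ := hγ.parent h1 h2 hb
  rw [hq] at hq2
  obtain ⟨rfl, rfl⟩ : q' = q'' ∧ c' = c'' := by simpa using hq2
  rcases ht q i h1 (by omega) with h | ⟨e, h⟩
  · exact Or.inl (h.trans hq)
  · cases h with
    | generate _ _ _ _ _ h => simp [hq] at h
    | reemit m r q2 d r' _ _ h hn =>
      rw [hq] at h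
      cases h
      rcases hn with hn | ⟨_, _, hn⟩
      · exact absurd hn.1.symm hqd
      · rcases hc with hc | rfl
        · cases hc
        · exact absurd ⟨_, hb⟩ hn
    | forward _ _ _ _ _ _ _ _ _ h => simp [hq] at h
    | deliver m r q2 _ h =>
      rw [hq] at h
      cases h
      exact absurd rfl hqd
    | propagate m r q2 d r' c2 _ _ h hp hch hS hb' =>
      rw [hq] at h
      cases h
      rw [hb] at hch
      cases hch
      exact Or.inr ⟨rfl, hS, hb'⟩
    | fail _ _ _ _ _ h => omega
    | erase m r q2 d c2 _ h hS _ _ hn _ =>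
      rw [hq] at h
      cases h
      rcases hn with h | h | h
      · exact absurd h.symm hqd
      · omega
      · rcases hc with hc | rfl
        · exact absurd hc hS
        · exact absurd ⟨_, hb⟩ h

/-- The type of a message of rank at least `2` only changes from `S`. -/
theorem BufTrans.type_step {γ γ' : Config A M} (ht : BufTrans γ γ') {p : V} {i : ℕ} {m : M}
    {r q d : V} {c : MsgType} (h1 : 1 ≤ i) (h2 : i ≤ G.diam + 1)
    (hb' : γ'.buf p i = some ⟨m, r, q, d, c⟩) :
    γ.buf p i = some ⟨m, r, q, d, c⟩ ∨ (c ≠ .S ∧ γ.buf p i = some ⟨m, r, q, d, .S⟩) ∨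
      (c = .S ∧ i = 1 ∧ r = γ.hop p d ∧ γ.buf p i = none) ∨
      (c = .S ∧ i = 1 ∧ (d ≠ p → r = γ.hop p d) ∧ ∃ r', γ.buf p i = some ⟨m, r', q, d, .F⟩ ∧
        (d = p → r' = r)) ∨
      (c = .S ∧ r = γ.hop p d ∧ γ.buf p i = none ∧ ∃ j, i = j + 1 ∧ 1 ≤ j ∧ j ≤ G.diam ∧
        q ≠ d ∧ ∃ q', γ.buf q j = some ⟨m, p, q', d, .S⟩) := by
  rcases ht p i h1 h2 with h | ⟨e, h⟩
  · exact Or.inl (h.symm.trans hb')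
  rw [hb'] at h
  cases h with
  | generate m d r _ hi hb h =>
    cases h
    exact Or.inr (Or.inr (Or.inl ⟨rfl, hi, rfl, hb⟩))
  | reemit m r q d r' _ hi hb hr h =>
    cases h
    refine Or.inr (Or.inr (Or.inr (Or.inl ⟨rfl, hi, fun h => ?_, _, hb, fun h => ?_⟩)))
    · rcases hr with hr | hr
      · exact absurd hr.1 h
      · exact hr.2.1
    · rcases hr with hr | hr
      · exact hr.2.symm
      · exact absurd h hr.1
  | forward j m s q d _ hi hj hj' hb _ hd hs h =>
    cases h
    exact Or.inr (Or.inr (Or.inr (Or.inr ⟨rfl, rfl, hb, j, hi, hj, hj', hd, _, hs⟩)))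
  | deliver m r q _ hb h =>
    cases h
    exact Or.inr (Or.inl ⟨nofun, hb⟩)
  | propagate m r q d r' c _ _ hb _ _ hS h =>
    cases h
    exact Or.inr (Or.inl ⟨hS, hb⟩)
  | fail m r q d _ _ hb _ h =>
    cases h
    exact Or.inr (Or.inl ⟨nofun, hb⟩)
  | erase _ _ _ _ _ _ _ _ _ _ _ h => cases h

/-- A parent survives as long as it has a child and can only copy the child's type. If the child
leaves `S` in this step, the parent was `S` and stays so, because it read the child's old type. For
a freshly forwarded copy, the sender could do nothing: it is not the destination and saw no child.
-/
theorem Linked.step {γ γ' : Config A M} (hγ : Linked γ) (ht : BufTrans γ γ') : Linked γ' where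
  adj := by
    intro p i m r q d c h1 h2 hb
    have hhop : ∀ d, G.Adj p (γ.hop p d) := fun d => A.nextHop_adj _ _ _
    rcases ht.type_step h1 h2 hb with h | ⟨_, h⟩ | ⟨_, _, rfl, _⟩ | ⟨_, _, h, r', h', h''⟩ |
      ⟨_, rfl, _⟩
    · exact hγ.adj h1 h2 h
    · exact hγ.adj h1 h2 h
    · exact hhop d
    · by_cases hd : d = p
      · exact h'' hd ▸ hγ.adj h1 h2 h'
      · exact h hd ▸ hhop d
    · exact hhop d
  parent := by
    intro p i m r q d c h1 h2 hb
    rcases ht.type_step (by omega) (by omega) hb with h | ⟨hS, h⟩ | ⟨_, h, _⟩ | ⟨_, h, _⟩ |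
      ⟨rfl, _, hn, j, hj, _, _, hd, q', hq⟩
    · obtain ⟨hqd, q', c', hq, hc⟩ := hγ.parent h1 h2 h
      rcases hγ.parent_step ht h1 h2 h hq with h' | ⟨_, _, h'⟩
      · exact ⟨hqd, _, _, h', hc⟩
      · exact ⟨hqd, _, _, h', Or.inr rfl⟩
    · obtain ⟨hqd, q', c', hq, hc⟩ := hγ.parent h1 h2 h
      rcases hγ.parent_step ht h1 h2 h hq with h' | ⟨_, h, _⟩
      · rcases hc with rfl | rfl
        all_goals exact ⟨hqd, _, _, h', Or.inl rfl⟩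
      · exact absurd rfl h
    · omega
    · omega
    · obtain rfl : i = j := by omega
      refine ⟨hd, q', .S, ?_, Or.inl rfl⟩
      rcases ht q i h1 (by omega) with h | ⟨e, h⟩
      · exact h.trans hq
      · cases h with
        | generate _ _ _ _ _ h => simp [hq] at h
        | reemit _ _ _ _ _ _ _ h => simp [hq] at h
        | forward _ _ _ _ _ _ _ _ _ h => simp [hq] at h
        | deliver m r q2 _ h =>
          rw [hq] at h
          cases h
          exact absurd rfl hd
        | propagate m r q2 d r' c2 _ _ h hp hch hS hb' =>
          rw [hq] at h
          cases h
          rw [hn] at hch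
          cases hch
        | fail _ _ _ _ _ h => omega
        | erase m r q2 d c2 _ h hS =>
          rw [hq] at h
          cases h
          exact absurd rfl hS

theorem NoMessage.linked {γ : Config A M} (h : NoMessage γ) : Linked γ where
  adj h1 h2 hb := by simp [h _ _ h1 h2] at hb
  parent h1 h2 hb := by simp [h _ _ (Nat.succ_le_succ (Nat.zero_le _)) (Nat.succ_le_succ h2)] at hb

namespace Execution

variable {Γ : Execution A M}

theorem bufTrans_of_linked {t : ℕ} (hD : 1 ≤ G.diam) (h : Linked (Γ.conf t)) :
    BufTrans (Γ.conf t) (Γ.conf (t + 1)) := fun p i _ _ => by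
  cases hf : Γ.fired t p i with
  | none => exact Or.inl (Γ.fired_idle t p i hf)
  | some e => exact Or.inr ⟨e, (Γ.fired_rule t p i e hf).bufStep h hD (Γ.choice_valid t)⟩

theorem linked (hD : 1 ≤ G.diam) (h : NoMessage (Γ.conf 0)) (t : ℕ) : Linked (Γ.conf t) := by
  induction t with
  | zero => exact h.linked
  | succ t ih => exact ih.step (bufTrans_of_linked hD ih)

theorem bufStep (hD : 1 ≤ G.diam) (h : NoMessage (Γ.conf 0)) {t : ℕ} {p : V} {i : ℕ} {e : Effect}
    (hf : Γ.fired t p i = some e) : BufStep (Γ.conf t) p i ((Γ.conf (t + 1)).buf p i) e :=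
  (Γ.fired_rule t p i e hf).bufStep (linked hD h t) hD (Γ.choice_valid t)

theorem bufTrans (hD : 1 ≤ G.diam) (h : NoMessage (Γ.conf 0)) (t : ℕ) :
    BufTrans (Γ.conf t) (Γ.conf (t + 1)) :=
  bufTrans_of_linked hD (linked hD h t)

theorem fired_rank {t : ℕ} {p : V} {i : ℕ} (hf : Γ.fired t p i ≠ none) :
    1 ≤ i ∧ i ≤ G.diam + 1 := by
  obtain ⟨e, he⟩ := Option.ne_none_iff_exists'.1 hf
  exact (Γ.fired_rule t p i e he).rank

/-- The table entry for `d = p` is a neighbor too, so the mere existence of a routing algorithm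
gives the network an edge. -/
theorem one_le_diam [Finite V] (hG : G.Connected) (Γ : Execution A M) : 1 ≤ G.diam := by
  have := hG.nonempty
  obtain ⟨p⟩ := hG.nonempty
  have hadj := A.nextHop_adj p ((Γ.conf 0).table p) p
  have := SimpleGraph.dist_le_diam (SimpleGraph.connected_iff_ediam_ne_top.1 hG)
    (u := p) (v := A.nextHop p ((Γ.conf 0).table p) p)
  rwa [SimpleGraph.dist_eq_one_iff_adj.2 hadj] at this

end Execution

end Links

/-! ### Which rules are enabled in a linked configuration -/

section Enabled

variable {V : Type u} {M : Type v} {G : SimpleGraph V} {A : RoutingAlgorithm.{u, w} G}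
  {γ : Config A M} {ch : V → ℕ → Option V}

theorem Linked.no_child_of_empty (hγ : Linked γ) {p : V} {i : ℕ} (h1 : 1 ≤ i) (h2 : i ≤ G.diam)
    (hb : γ.buf p i = none) (x : V) (m : M) (d : V) :
    ¬ ∃ r c, γ.buf x (i + 1) = some ⟨m, r, p, d, c⟩ := by
  rintro ⟨r, c, h⟩
  obtain ⟨-, q', c', hq, -⟩ := hγ.parent h1 h2 h
  simp [hb] at hq

theorem exists_fires_deliver {p : V} {i : ℕ} {m : M} {r q : V} (h1 : 1 ≤ i)
    (h2 : i ≤ G.diam + 1) (hb : γ.buf p i = some ⟨m, r, q, p, .S⟩) :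
    ∃ b e, Fires γ ch p i b e := by
  rcases h1.eq_or_lt with rfl | h1
  · exact ⟨_, _, .R4 m r q hb⟩
  · exact ⟨_, _, .R10 i m r q h1 h2 hb⟩

/-- `choice` may select another candidate than `p`, so the rule obtained need not forward `m`. The
last guard of `R8` is automatic: an empty buffer has no children. -/
theorem Linked.exists_fires_forward (hγ : Linked γ) (hch : ValidChoice γ ch) {p r : V} {i : ℕ}
    {m : M} {q d : V} (h1 : 1 ≤ i) (h2 : i ≤ G.diam) (hr : γ.buf r (i + 1) = none)
    (hb : γ.buf p i = some ⟨m, r, q, d, .S⟩) (hpd : p ≠ d) :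
    ∃ b e, Fires γ ch r (i + 1) b e := by
  have hv := hch r (i + 1) (by omega) (by omega)
  have hc : Candidate γ r (i + 1) p := ⟨(hγ.adj h1 (by omega) hb).symm, m, q, d, hb, hpd⟩
  cases hs : ch r (i + 1) with
  | none => exact absurd hc (hv.2 hs p)
  | some s =>
    obtain ⟨-, m', q', d', hb', -⟩ := hv.1 s hs
    rcases h2.eq_or_lt with rfl | h2
    · exact ⟨_, _, .R12 m' s q' d' hr hs hb'⟩
    · exact ⟨_, _, .R8 (i + 1) m' s q' d' (by omega) h2 hr hs hb'
        (hγ.no_child_of_empty (by omega) h2 hr _ _ _)⟩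

theorem exists_fires_erase {p : V} {i : ℕ} {m : M} {r q d q' : V} {c : MsgType} (h1 : 1 ≤ i)
    (h2 : i ≤ G.diam) (hb : γ.buf p (i + 1) = some ⟨m, r, q, d, c⟩) (hc : c ≠ .S)
    (hq : γ.buf q i = some ⟨m, p, q', d, c⟩)
    (hn : i + 1 ≤ G.diam → ¬ ∃ r', γ.buf r (i + 2) = some ⟨m, r', p, d, c⟩) :
    ∃ b e, Fires γ ch p (i + 1) b e := by
  by_cases hd : d = p
  · subst hd
    exact ⟨_, _, .R11 (i + 1) m r q q' c (by omega) (by omega) hb hc hq⟩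
  · rcases h2.eq_or_lt with rfl | h2
    · exact ⟨_, _, .R14 m r q d q' c hb hc hd hq⟩
    · exact ⟨_, _, .R9 (i + 1) m r q d q' c (by omega) h2 hb hc hd hq (hn h2)⟩

theorem exists_fires_root {p : V} {m : M} {r q d : V} {c : MsgType}
    (hb : γ.buf p 1 = some ⟨m, r, q, d, c⟩) (hc : c ≠ .S)
    (hn : ¬ ∃ r', γ.buf r 2 = some ⟨m, r', p, d, c⟩) :
    ∃ b e, Fires γ ch p 1 b e := by
  by_cases hd : d = p
  · subst hd
    cases c with
    | S => exact absurd rfl hc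
    | A => exact ⟨_, _, .R5 m r q hb⟩
    | F => exact ⟨_, _, .R6 m r q hb⟩
  · cases c with
    | S => exact absurd rfl hc
    | A => exact ⟨_, _, .R3 m r q d hb hd hn⟩
    | F => exact ⟨_, _, .R2 m r q d hb hd hn⟩

/-- A linked configuration in which no rule is enabled contains no message. -/
theorem Linked.noMessage_of_not_fires (hγ : Linked γ) (hD : 1 ≤ G.diam) (hch : ValidChoice γ ch)
    (h : ∀ p i b e, ¬ Fires γ ch p i b e) : NoMessage γ := by
  have h' : ∀ p i, ¬ ∃ b e, Fires γ ch p i b e := fun p i ⟨b, e, hf⟩ => h p i b e hf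
  -- Descending induction on the rank: an acknowledgment of highest rank has no child of its type,
  -- so either its parent is `S` and can copy it, or it can be erased (at rank 1, erased or
  -- re-emitted).
  have key : ∀ k i, 1 ≤ i → i + k = G.diam + 1 → ∀ p m r q d c,
      γ.buf p i = some ⟨m, r, q, d, c⟩ → c = .S := by
    intro k
    induction k with
    | zero =>
      intro i _ hi p m r q d c hb
      obtain rfl : i = G.diam + 1 := hi
      by_contra hc
      obtain ⟨hqd, q', c', hq, rfl | rfl⟩ := hγ.parent hD le_rfl hb
      · exact h' _ _ ⟨_, _, .R7 _ m p q' d r c hD le_rfl hq hqd hb hc⟩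
      · exact h' _ _ (exists_fires_erase hD le_rfl hb hc hq (by omega))
    | succ k ih =>
      intro i h1 hi p m r q d c hb
      by_contra hc
      have hn : ¬ ∃ r', γ.buf r (i + 1) = some ⟨m, r', p, d, c⟩ := fun ⟨r', hr⟩ =>
        hc (ih (i + 1) (by omega) (by omega) _ _ _ _ _ _ hr)
      rcases h1.eq_or_lt with rfl | h1
      · exact h' _ _ (exists_fires_root hb hc hn)
      · obtain ⟨j, rfl⟩ : ∃ j, i = j + 1 := ⟨i - 1, by omega⟩
        obtain ⟨hqd, q', c', hq, rfl | rfl⟩ := hγ.parent (by omega) (by omega) hb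
        · exact h' _ _ ⟨_, _, .R7 _ m p q' d r c (by omega) (by omega) hq hqd hb hc⟩
        · exact h' _ _ (exists_fires_erase (by omega) (by omega) hb hc hq fun _ => hn)
  -- Only `S` remains; from the top rank down, such a message could be delivered, fail, or move to
  -- the next rank, already known to be empty.
  have key' : ∀ k i, 1 ≤ i → i + k = G.diam + 1 → ∀ p, γ.buf p i = none := by
    intro k
    induction k with
    | zero =>
      intro i h1 hi p
      obtain rfl : i = G.diam + 1 := hi
      cases hb : γ.buf p (G.diam + 1) with
      | none => rfl
      | some x =>
        obtain ⟨m, r, q, d, c⟩ := x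
        obtain rfl := key 0 _ h1 rfl _ _ _ _ _ _ hb
        by_cases hd : d = p
        · subst hd
          exact (h' _ _ (exists_fires_deliver h1 le_rfl hb)).elim
        · exact (h _ _ _ _ (.R13 m r q d hb hd)).elim
    | succ k ih =>
      intro i h1 hi p
      cases hb : γ.buf p i with
      | none => rfl
      | some x =>
        obtain ⟨m, r, q, d, c⟩ := x
        obtain rfl := key _ _ h1 hi _ _ _ _ _ _ hb
        by_cases hd : p = d
        · subst hd
          exact (h' _ _ (exists_fires_deliver h1 (by omega) hb)).elim
        · exact (h' _ _ (hγ.exists_fires_forward hch h1 (by omega)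
            (ih (i + 1) (by omega) (by omega) r) hb hd)).elim
  exact fun p i h1 h2 => key' (G.diam + 1 - i) i h1 (by omega) p

/-- In linked configurations, the enabled rules depend on the buffers, the tables and
the request only. -/
theorem Fires.exists_congr {γ' : Config A M} {ch' : V → ℕ → Option V} (hγ' : Linked γ')
    (hD : 1 ≤ G.diam) (hch : ValidChoice γ ch) (hch' : ValidChoice γ' ch')
    (hbuf : γ'.buf = γ.buf) (htable : γ'.table = γ.table) {p : V} {i : ℕ}
    {b : Option (Msg V M)} {e : Effect} (hreq : γ'.req p = γ.req p ∨ γ.req p = none)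
    (h : Fires γ ch p i b e) : ∃ b e, Fires γ' ch' p i b e := by
  obtain ⟨table, buf, req⟩ := γ
  obtain ⟨table', buf', req'⟩ := γ'
  obtain rfl : buf' = buf := hbuf
  obtain rfl : table' = table := htable
  -- The new value of `choice` may differ, but a candidate still exists, so some forwarding remains
  -- possible.
  have hfwd : ∀ {s m q d} j, 1 ≤ j → j ≤ G.diam → buf' p (j + 1) = none → ch p (j + 1) = some s →
      buf' s j = some ⟨m, p, q, d, .S⟩ → ∃ b e, Fires ⟨table', buf', req'⟩ ch' p (j + 1) b e := by
    intro s m q d j h1 h2 hb hs hsb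
    obtain ⟨-, m', q', d', hb', hd⟩ := (hch p (j + 1) (by omega) (by omega)).1 s hs
    exact hγ'.exists_fires_forward hch' h1 h2 hb hb' hd
  cases h with
  | R1 m d r hr hb hn ha =>
    rcases hreq with h | h
    · exact ⟨_, _, .R1 m d r (h.trans hr) hb hn ha⟩
    · rw [hr] at h
      cases h
  | R2 m r q d hb hd hn => exact ⟨_, _, .R2 m r q d hb hd hn⟩
  | R3 m r q d hb hd hn => exact ⟨_, _, .R3 m r q d hb hd hn⟩
  | R4 m r q hb => exact ⟨_, _, .R4 m r q hb⟩
  | R5 m r q hb => exact ⟨_, _, .R5 m r q hb⟩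
  | R6 m r q hb => exact ⟨_, _, .R6 m r q hb⟩
  | R7 _ m r q d r' c h1 h2 hb hp hc hS => exact ⟨_, _, .R7 _ m r q d r' c h1 h2 hb hp hc hS⟩
  | R8 _ m s q d h1 h2 hb hs hc _ =>
    obtain ⟨j, rfl⟩ : ∃ j, i = j + 1 := ⟨i - 1, by omega⟩
    exact hfwd j (by omega) (by omega) hb hs hc
  | R9 _ m r q d q' c h1 h2 hb hS hd hq hn => exact ⟨_, _, .R9 _ m r q d q' c h1 h2 hb hS hd hq hn⟩
  | R10 _ m r q h1 h2 hb => exact ⟨_, _, .R10 _ m r q h1 h2 hb⟩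
  | R11 _ m r q q' c h1 h2 hb hS hq => exact ⟨_, _, .R11 _ m r q q' c h1 h2 hb hS hq⟩
  | R12 m s q d hb hs hc => exact hfwd _ hD le_rfl hb hs hc
  | R13 m r q d hb hd => exact ⟨_, _, .R13 m r q d hb hd⟩
  | R14 m r q d q' c hb hS hd hq => exact ⟨_, _, .R14 m r q d q' c hb hS hd hq⟩
  | R15 _ m r q d c h1 h2 hb hS hn hq => exact ⟨_, _, .R15 _ m r q d c h1 h2 hb hS hn hq⟩
  | R16 _ m r q d q' c c' h1 h2 hb hS hn hq hc =>
    exact ⟨_, _, .R16 _ m r q d q' c c' h1 h2 hb hS hn hq hc⟩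
  | R17 m r q d c hb hS hq => exact ⟨_, _, .R17 m r q d c hb hS hq⟩
  | R18 m r q d q' c c' hb hS hq hc => exact ⟨_, _, .R18 m r q d q' c c' hb hS hq hc⟩

end Enabled

/-! ### After convergence, rounds require active steps -/

namespace Execution

variable {V : Type u} {M : Type v} {G : SimpleGraph V} {A : RoutingAlgorithm.{u, w} G}
  {Γ : Execution A M}

/-- Some rule of the protocol is executed in step `t`. -/
def ActiveAt (Γ : Execution A M) (t : ℕ) : Prop := ∃ p i, Γ.fired t p i ≠ none

theorem table_succ_of_not_enabled {t : ℕ} (h : ∀ p, ¬ A.Enabled (Γ.conf t).table p) :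
    (Γ.conf (t + 1)).table = (Γ.conf t).table :=
  funext fun p => Γ.routed_idle t p fun hr => h p ⟨_, Γ.routed_act t p hr⟩

theorem table_eq_of_converged {t₀ t : ℕ} (h : A.Converged (Γ.conf t₀).table) (ht : t₀ ≤ t) :
    (Γ.conf t).table = (Γ.conf t₀).table := by
  induction t, ht using Nat.le_induction with
  | base => rfl
  | succ t ht ih => exact (table_succ_of_not_enabled (by rw [ih]; exact h.2)).trans ih

theorem converged_mono {t₀ t : ℕ} (h : A.Converged (Γ.conf t₀).table) (ht : t₀ ≤ t) :
    A.Converged (Γ.conf t).table :=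
  table_eq_of_converged h ht ▸ h

theorem dist_hop {t₀ t : ℕ} (h : A.Converged (Γ.conf t₀).table) (ht : t₀ ≤ t) {p d : V}
    (hpd : p ≠ d) : G.dist ((Γ.conf t).hop p d) d + 1 = G.dist p d :=
  (converged_mono h ht).1 p d hpd

theorem acts_iff_fired {t : ℕ} (h : A.Converged (Γ.conf t).table) {p : V} :
    Γ.Acts t p ↔ ∃ i, Γ.fired t p i ≠ none :=
  ⟨fun h' => h'.resolve_left fun hr => h.2 p ⟨_, Γ.routed_act t p hr⟩, Or.inr⟩

theorem enabled_iff_fires {t : ℕ} (h : A.Converged (Γ.conf t).table) {p : V} :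
    Γ.Enabled t p ↔ ∃ i b e, Fires (Γ.conf t) (Γ.choice t) p i b e :=
  ⟨fun h' => h'.resolve_left (h.2 p), Or.inr⟩

/-- Buffers and tables are frozen, and the higher layer can only add a request where there was none,
which disables nothing. -/
theorem enabled_succ_of_not_activeAt (hD : 1 ≤ G.diam) (h0 : NoMessage (Γ.conf 0)) {t : ℕ}
    (h : A.Converged (Γ.conf t).table) (ha : ¬ Γ.ActiveAt t) {p : V} (hp : Γ.Enabled t p) :
    Γ.Enabled (t + 1) p := by
  have hn : ∀ p i, Γ.fired t p i = none := fun p i => by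
    by_contra hf
    exact ha ⟨p, i, hf⟩
  obtain ⟨i, b, e, hf⟩ := (enabled_iff_fires h).1 hp
  refine Or.inr ⟨i, hf.exists_congr (linked hD h0 (t + 1)) hD (Γ.choice_valid t)
    (Γ.choice_valid (t + 1)) ?_ (table_succ_of_not_enabled h.2)
    (Γ.req_step t p (by simp [hn]))⟩
  funext p i
  exact Γ.fired_idle t p i (hn p i)

/-- Without an active step `p` could not be neutralized, so it would have to act, and after
convergence acting means executing a forwarding rule. -/
theorem exists_activeAt_of_enabled [Finite V] (hD : 1 ≤ G.diam) (h0 : NoMessage (Γ.conf 0))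
    (hfair : Γ.Fair) {t : ℕ} (h : A.Converged (Γ.conf t).table) {p : V} (hp : Γ.Enabled t p) :
    ∃ s, t ≤ s ∧ s < roundEnd Γ.Enabled Γ.Acts t ∧ Γ.ActiveAt s := by
  obtain ⟨s, h1, h2, h3⟩ := (roundEnd_spec hfair t).2 p hp
  refine ⟨s, h1, h2, ?_⟩
  rcases h3 with h3 | ⟨h3, h4⟩
  · exact ⟨p, (acts_iff_fired (converged_mono h h1)).1 h3⟩
  · by_contra ha
    exact h4 (enabled_succ_of_not_activeAt hD h0 (converged_mono h h1) ha h3)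

theorem noMessage_of_not_activeAt [Finite V] (hD : 1 ≤ G.diam) (h0 : NoMessage (Γ.conf 0))
    (hfair : Γ.Fair) {t : ℕ} (h : A.Converged (Γ.conf t).table)
    (ha : ∀ s, t ≤ s → ¬ Γ.ActiveAt s) : NoMessage (Γ.conf t) := by
  refine (linked hD h0 t).noMessage_of_not_fires hD (Γ.choice_valid t) fun p i b e hf => ?_
  obtain ⟨s, h1, -, h2⟩ := exists_activeAt_of_enabled hD h0 hfair h (Or.inr ⟨i, b, e, hf⟩ :
    Γ.Enabled t p)
  exact ha s h1 h2

/-- The tables follow an execution of `A` alone, with pauses. By priority, a processor enabled for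
`A` that acts executes `A`, so R rounds of `A` fit into R rounds of the composition. -/
theorem converged_of_stabilizes [Finite V] {R : ℕ} (hA : A.StabilizesWithin R) (hfair : Γ.Fair) :
    A.Converged (Γ.conf (roundBoundary Γ.Enabled Γ.Acts 0 R)).table := by
  have hac : ∀ t p, A.Enabled (Γ.conf t).table p → Γ.Acts t p → Γ.routed t p :=
    fun t p hp h => h.resolve_right fun ⟨i, hi⟩ => hi (Γ.priority t p i hp)
  have hex : A.IsExecution (fun t => (Γ.conf t).table) Γ.routed :=
    { step_act := Γ.routed_act
      step_idle := Γ.routed_idle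
      fair := fun p t h => by
        obtain ⟨s, hs, ha⟩ := hfair p t fun s hs => Or.inl (h s hs)
        exact ⟨s, hs, hac s p (h s hs) ha⟩ }
  exact converged_mono (hA _ _ hex) (roundBoundary_le_of_priority hfair hex.fair
    (fun _ _ => Or.inl) hac 0 R)

end Execution

/-! ### Conservation inequalities -/

section Counting

variable {V : Type u} [Fintype V]

open Classical in
/-- The number of processors with a given property. -/
noncomputable def count (P : V → Prop) : ℕ := ∑ p : V, if P p then 1 else 0

theorem count_eq_card (P : V → Prop) [DecidablePred P] :
    count P = (Finset.univ.filter P).card := by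
  classical
  rw [count, Finset.card_filter]
  exact Finset.sum_congr rfl fun p _ => by congr

theorem count_eq_zero {P : V → Prop} (h : ∀ p, ¬ P p) : count P = 0 := by
  simp [count, h]

theorem one_le_count {P : V → Prop} {p : V} (h : P p) : 1 ≤ count P := by
  classical
  rw [count_eq_card]
  exact Finset.card_pos.2 ⟨p, by simpa using h⟩

theorem count_le_card (P : V → Prop) : count P ≤ Fintype.card V := by
  classical
  rw [count_eq_card]
  exact Finset.card_le_univ _

/-- One step of a reservoir: `X` and `X'` are its contents before and after, `Z` the inflow, and
each element of `Y` is paid for by a distinct element that leaves. -/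
theorem count_add_le_of_injOn {X X' Y Z : V → Prop} (f : V → V)
    (hX : ∀ p, X' p → X p ∨ Z p) (hY : ∀ p, Y p → X (f p) ∧ ¬ X' (f p))
    (hf : Set.InjOn f {p | Y p}) : count X' + count Y ≤ count X + count Z := by
  classical
  simp only [count_eq_card]
  have h1 : (Finset.univ.filter Y).card ≤ (Finset.univ.filter fun p => X p ∧ ¬ X' p).card :=
    Finset.card_le_card_of_injOn f (fun p hp => by simpa using hY p (by simpa using hp))
      (fun p hp q hq => hf (by simpa using hp) (by simpa using hq))
  have h2 : (Finset.univ.filter X').card ≤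
      (Finset.univ.filter fun p => X p ∧ X' p).card + (Finset.univ.filter Z).card := by
    refine (Finset.card_le_card fun p hp => ?_).trans (Finset.card_union_le _ _)
    have hp : X' p := by simpa using hp
    have := hX p hp
    simp only [Finset.mem_union, Finset.mem_filter, Finset.mem_univ, true_and]
    tauto
  have h3 : (Finset.univ.filter X).card = (Finset.univ.filter fun p => X p ∧ X' p).card +
      (Finset.univ.filter fun p => X p ∧ ¬ X' p).card := by
    rw [← Finset.card_filter_add_card_filter_not (s := Finset.univ.filter X) X',
      Finset.filter_filter, Finset.filter_filter]
  omega

theorem add_sum_Ico_le {f a b : ℕ → ℕ} {t₀ : ℕ}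
    (h : ∀ t, t₀ ≤ t → f (t + 1) + a t ≤ f t + b t) {T : ℕ} (hT : t₀ ≤ T) :
    f T + ∑ t ∈ Finset.Ico t₀ T, a t ≤ f t₀ + ∑ t ∈ Finset.Ico t₀ T, b t := by
  induction T, hT using Nat.le_induction with
  | base => simp
  | succ T hT ih =>
    rw [Finset.sum_Ico_succ_top hT, Finset.sum_Ico_succ_top hT]
    have := h T hT
    omega

end Counting

/-! ### Flow of copies upwards and of acknowledgments downwards -/

section Types

variable {V : Type u} {M : Type v} {G : SimpleGraph V} {A : RoutingAlgorithm.{u, w} G}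

/-- The buffer of rank `i` of `p` contains a message of type `c`. -/
def HasType (γ : Config A M) (c : MsgType) (i : ℕ) (p : V) : Prop :=
  ∃ m r q d, γ.buf p i = some ⟨m, r, q, d, c⟩

theorem HasType.unique {γ : Config A M} {c c' : MsgType} {i : ℕ} {p : V} (h : HasType γ c i p)
    (h' : HasType γ c' i p) : c = c' := by
  obtain ⟨m, r, q, d, h⟩ := h
  obtain ⟨m', r', q', d', h'⟩ := h'
  rw [h] at h'
  cases h'
  rfl

/-- The buffer contains a message of type `S` without copy at the next rank. -/
def Ready (γ : Config A M) (i : ℕ) (p : V) : Prop :=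
  ∃ m r q d, γ.buf p i = some ⟨m, r, q, d, .S⟩ ∧ ¬ ∃ r' c, γ.buf r (i + 1) = some ⟨m, r', p, d, c⟩

/-- The buffer of rank `i + 1` contains an acknowledgment not yet taken over at rank `i`. -/
def Waiting (γ : Config A M) (i : ℕ) (p : V) : Prop :=
  ∃ m r q d q', γ.buf p (i + 1) = some ⟨m, r, q, d, .A⟩ ∧ γ.buf q i = some ⟨m, p, q', d, .S⟩

/-- The last processor of the message in a buffer. -/
def lastOf (γ : Config A M) (i : ℕ) (p : V) : V := ((γ.buf p i).map Msg.last).getD p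

/-- The next processor of the message in a buffer. -/
def nextOf (γ : Config A M) (i : ℕ) (p : V) : V := ((γ.buf p i).map Msg.next).getD p

theorem lastOf_eq {γ : Config A M} {i : ℕ} {p : V} {m : M} {r q d : V} {c : MsgType}
    (h : γ.buf p i = some ⟨m, r, q, d, c⟩) : lastOf γ i p = q := by simp [lastOf, h]

theorem nextOf_eq {γ : Config A M} {i : ℕ} {p : V} {m : M} {r q d : V} {c : MsgType}
    (h : γ.buf p i = some ⟨m, r, q, d, c⟩) : nextOf γ i p = r := by simp [nextOf, h]

/-- Provides a left inverse of `lastOf` on occupied buffers, hence distinct parents for distinct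
copies. -/
theorem Linked.nextOf_lastOf {γ : Config A M} (hγ : Linked γ) {i : ℕ} (h1 : 1 ≤ i)
    (h2 : i ≤ G.diam) {p : V} (hp : γ.buf p (i + 1) ≠ none) :
    nextOf γ i (lastOf γ (i + 1) p) = p := by
  obtain ⟨⟨m, r, q, d, c⟩, hb⟩ := Option.ne_none_iff_exists'.1 hp
  obtain ⟨-, q', c', hq, -⟩ := hγ.parent h1 h2 hb
  rw [lastOf_eq hb, nextOf_eq hq]

theorem Linked.injOn_lastOf {γ : Config A M} (hγ : Linked γ) {i : ℕ} (h1 : 1 ≤ i)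
    (h2 : i ≤ G.diam) {P : V → Prop} (hP : ∀ p, P p → γ.buf p (i + 1) ≠ none) :
    Set.InjOn (lastOf γ (i + 1)) {p | P p} := fun p hp q hq h => by
  rw [← hγ.nextOf_lastOf h1 h2 (hP p hp), h, hγ.nextOf_lastOf h1 h2 (hP q hq)]

theorem Linked.not_ready_lastOf {γ : Config A M} (hγ : Linked γ) {i : ℕ} (h1 : 1 ≤ i)
    (h2 : i ≤ G.diam) {p : V} (hp : γ.buf p (i + 1) ≠ none) :
    γ.buf (lastOf γ (i + 1) p) i ≠ none ∧ ¬ Ready γ i (lastOf γ (i + 1) p) := by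
  obtain ⟨⟨m, r, q, d, c⟩, hb⟩ := Option.ne_none_iff_exists'.1 hp
  obtain ⟨-, q', c', hq, -⟩ := hγ.parent h1 h2 hb
  rw [lastOf_eq hb]
  refine ⟨by simp [hq], ?_⟩
  rintro ⟨m', r', q'', d', h, hn⟩
  rw [hq] at h
  cases h
  exact hn ⟨_, _, hb⟩

theorem Linked.count_add_count_ready_le [Fintype V] {γ : Config A M} (hγ : Linked γ) {i : ℕ}
    (h1 : 1 ≤ i) (h2 : i ≤ G.diam) :
    count (Ready γ i) + count (fun p => γ.buf p (i + 1) ≠ none) ≤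
      count fun p => γ.buf p i ≠ none := by
  have := count_add_le_of_injOn (X := fun p => γ.buf p i ≠ none) (X' := Ready γ i)
    (Z := fun _ => False) (lastOf γ (i + 1))
    (fun p ⟨m, r, q, d, h, _⟩ => Or.inl (by simp [h])) (fun p hp => hγ.not_ready_lastOf h1 h2 hp)
    (hγ.injOn_lastOf h1 h2 fun _ h => h)
  rwa [count_eq_zero (P := fun _ => False) fun _ => id] at this

/-- A message is not erased before the preceding copy has taken its type. -/
theorem BufTrans.child_step {γ γ' : Config A M} (ht : BufTrans γ γ') {p q : V} {i : ℕ} {m : M}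
    {r q' d : V} {c : MsgType} (h1 : 1 ≤ i) (h2 : i ≤ G.diam)
    (hb : γ.buf p (i + 1) = some ⟨m, r, q, d, c⟩) (hq : γ.buf q i = some ⟨m, p, q', d, .S⟩) :
    ∃ c', γ'.buf p (i + 1) = some ⟨m, r, q, d, c'⟩ := by
  rcases ht p (i + 1) (by omega) (by omega) with h | ⟨e, h⟩
  · exact ⟨c, h.trans hb⟩
  · cases h with
    | generate _ _ _ _ h => omega
    | reemit _ _ _ _ _ _ h => omega
    | forward _ _ _ _ _ _ _ _ _ h => simp [hb] at h
    | deliver m r q2 _ h h' =>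
      rw [hb] at h
      cases h
      exact ⟨_, h'⟩
    | propagate m r q2 d r' c2 _ _ h hp hch hS h' =>
      rw [hb] at h
      cases h
      exact ⟨_, h'⟩
    | fail _ _ _ _ _ _ h _ h' =>
      rw [hb] at h
      cases h
      exact ⟨_, h'⟩
    | erase m r q2 d c2 _ h hS _ hpar hn _ =>
      rw [hb] at h
      cases h
      obtain ⟨q3, h3⟩ := hpar i rfl h1
      rw [hq] at h3
      cases h3
      exact absurd rfl hS

/-- A step brings a message of type `S` into the buffer. -/
def Created (γ γ' : Config A M) (i : ℕ) (p : V) : Prop :=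
  HasType γ' .S i p ∧ ¬ HasType γ .S i p

/-- A step gives the type `A` to the message in the buffer. -/
def Acked (γ γ' : Config A M) (i : ℕ) (p : V) : Prop :=
  HasType γ' .A i p ∧ ¬ HasType γ .A i p

theorem BufTrans.created_succ {γ γ' : Config A M} (ht : BufTrans γ γ') {i : ℕ} (h1 : 1 ≤ i)
    (h2 : i ≤ G.diam) {p : V} (h : Created γ γ' (i + 1) p) :
    ∃ m s q d, γ'.buf p (i + 1) = some ⟨m, γ.hop p d, s, d, .S⟩ ∧ γ.buf p (i + 1) = none ∧
      γ.buf s i = some ⟨m, p, q, d, .S⟩ := by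
  obtain ⟨⟨m, r, q, d, h⟩, hn⟩ := h
  rcases ht.type_step (by omega) (by omega) h with h' | ⟨h', _⟩ | ⟨_, h', _⟩ | ⟨_, h', _⟩ |
    ⟨_, rfl, hb, j, hj, _, _, _, q', hq⟩
  · exact absurd ⟨_, _, _, _, h'⟩ hn
  · exact absurd rfl h'
  · omega
  · omega
  · cases hj
    exact ⟨_, _, _, _, h, hb, hq⟩

/-- A buffer cannot lose one `S` message and receive another in a single step, since reception
requires an empty buffer or an `F` at rank 1. -/
theorem BufTrans.type_S_step {γ γ' : Config A M} (ht : BufTrans γ γ') {p : V} {i : ℕ} {m : M}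
    {r q d : V} (h1 : 1 ≤ i) (h2 : i ≤ G.diam + 1)
    (hb' : γ'.buf p i = some ⟨m, r, q, d, .S⟩) (hS : HasType γ .S i p) :
    γ.buf p i = some ⟨m, r, q, d, .S⟩ := by
  obtain ⟨m', r', q', d', hS⟩ := hS
  rcases ht.type_step h1 h2 hb' with h | ⟨h, _⟩ | ⟨_, _, _, h⟩ | ⟨_, _, _, _, h, _⟩ |
    ⟨_, _, h, _⟩
  · exact h
  · exact absurd rfl h
  all_goals rw [hS] at h; cases h

theorem BufTrans.type_A_step {γ γ' : Config A M} (ht : BufTrans γ γ') {p : V} {i : ℕ} {m : M}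
    {r q d : V} (h1 : 1 ≤ i) (h2 : i ≤ G.diam + 1)
    (hb' : γ'.buf p i = some ⟨m, r, q, d, .A⟩) (hA : HasType γ .A i p) :
    γ.buf p i = some ⟨m, r, q, d, .A⟩ := by
  obtain ⟨m', r', q', d', hA⟩ := hA
  rcases ht.type_step h1 h2 hb' with h | ⟨_, h⟩ | ⟨h, _⟩ | ⟨h, _⟩ | ⟨h, _⟩
  · exact h
  · rw [hA] at h
    cases h
  all_goals cases h

/-- `Ready` buffers of rank i form the reservoir: filled by creations at rank i, and drained by each
creation at rank i + 1. A drained sender does not become ready again while it holds the same `S`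
message, because its copy is not erased before it takes the copy's type. -/
theorem Linked.count_created_step [Fintype V] {γ γ' : Config A M} (hγ : Linked γ)
    (ht : BufTrans γ γ') {i : ℕ} (h1 : 1 ≤ i) (h2 : i ≤ G.diam) :
    count (Ready γ' i) + count (Created γ γ' (i + 1)) ≤
      count (Ready γ i) + count (Created γ γ' i) := by
  have hne : ∀ p, Created γ γ' (i + 1) p → γ'.buf p (i + 1) ≠ none :=
    fun p ⟨⟨m, r, q, d, h⟩, _⟩ => by simp [h]
  refine count_add_le_of_injOn (lastOf γ' (i + 1)) (fun p hp => ?_) (fun p hp => ?_)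
    ((hγ.step ht).injOn_lastOf h1 h2 hne)
  · by_cases hc : HasType γ .S i p
    · refine Or.inl ?_
      obtain ⟨m, r, q, d, h, hn⟩ := hp
      have h' := ht.type_S_step h1 (by omega) h hc
      refine ⟨m, r, q, d, h', fun ⟨r', c, h3⟩ => hn ?_⟩
      obtain ⟨c', h4⟩ := ht.child_step h1 h2 h3 h'
      exact ⟨_, _, h4⟩
    · obtain ⟨m, r, q, d, h, -⟩ := hp
      exact Or.inr ⟨⟨m, r, q, d, h⟩, hc⟩
  · refine ⟨?_, ((hγ.step ht).not_ready_lastOf h1 h2 (hne p hp)).2⟩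
    obtain ⟨m, s, q, d, h3, h4, h5⟩ := ht.created_succ h1 h2 hp
    rw [lastOf_eq h3]
    exact ⟨m, p, q, d, h5, by simp [h4]⟩

/-- A step propagates an acknowledgment to the buffer. -/
def AckPropagated (γ γ' : Config A M) (i : ℕ) (p : V) : Prop :=
  HasType γ' .A i p ∧ i ≤ G.diam ∧ ∃ m r q d r', γ.buf p i = some ⟨m, r, q, d, .S⟩ ∧
    γ.buf r (i + 1) = some ⟨m, r', p, d, .A⟩

/-- The dual reservoir consists of waiting acknowledgments: filled at rank i + 1, drained by
propagation to rank i. Distinct parents drain distinct children, because a child names its parent in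
the `last` field. -/
theorem Linked.count_ackPropagated_step [Fintype V] {γ γ' : Config A M} (hγ : Linked γ)
    (ht : BufTrans γ γ') {i : ℕ} (h1 : 1 ≤ i) (h2 : i ≤ G.diam) :
    count (Waiting γ' i) + count (AckPropagated γ γ' i) ≤
      count (Waiting γ i) + count (Acked γ γ' (i + 1)) := by
  refine count_add_le_of_injOn (nextOf γ i) (fun p hp => ?_) (fun p hp => ?_)
    (fun p hp s hs h => ?_)
  · obtain ⟨m, r, q, d, q', h, hq⟩ := hp
    by_cases hc : HasType γ .A (i + 1) p
    · have h3 := ht.type_A_step (by omega) (by omega) h hc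
      obtain ⟨hqd, q2, c', hq2, rfl | rfl⟩ := hγ.parent h1 h2 h3
      · exact Or.inl ⟨_, _, _, _, _, h3, hq2⟩
      · rcases hγ.parent_step ht h1 h2 h3 hq2 with h4 | ⟨h4, _⟩
        · rw [hq] at h4
          cases h4
        · cases h4
    · exact Or.inr ⟨⟨_, _, _, _, h⟩, hc⟩
  · obtain ⟨hA, -, m, r, q, d, r', h, hr⟩ := hp
    rw [nextOf_eq h]
    refine ⟨⟨_, _, _, _, _, hr, h⟩, ?_⟩
    rintro ⟨m2, r2, q2, d2, q3, h3, h4⟩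
    have h5 := ht.type_A_step (by omega) (by omega) h3 ⟨_, _, _, _, hr⟩
    rw [hr] at h5
    cases h5
    exact nomatch hA.unique ⟨_, _, _, _, h4⟩
  · obtain ⟨-, -, m, r, q, d, r', h1, h2⟩ := hp
    obtain ⟨-, -, m', r2, q2, d2, r3, h3, h4⟩ := hs
    rw [nextOf_eq h1, nextOf_eq h3] at h
    subst h
    rw [h2] at h4
    cases h4
    rfl

end Types

/-! ### A potential for the rules executed on one buffer content -/

section Weight

variable {V : Type u} {M : Type v} {G : SimpleGraph V} {A : RoutingAlgorithm.{u, w} G}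

/-- The number of rules that may still be executed on the present content of a buffer. -/
def weight : Option (Msg V M) → ℕ
  | none => 0
  | some ⟨_, _, _, _, .S⟩ => 2
  | some ⟨_, _, _, _, .A⟩ => 1
  | some ⟨_, _, _, _, .F⟩ => 1

theorem weight_le_two (b : Option (Msg V M)) : weight b ≤ 2 := by
  rcases b with _ | ⟨_, _, _, _, _ | _ | _⟩ <;> simp [weight]

/-- The rules that raise the weight (generation, re-emission, forwarding) are exactly those that
count as `Created`. -/
theorem BufStep.weight_lt {γ γ' : Config A M} {p : V} {i : ℕ} {e : Effect}
    (h : BufStep γ p i (γ'.buf p i) e) (hc : ¬ Created γ γ' i p) :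
    weight (γ'.buf p i) + 1 ≤ weight (γ.buf p i) := by
  cases h with
  | generate m d r _ _ hb h =>
    refine absurd ⟨⟨_, _, _, _, h⟩, ?_⟩ hc
    rintro ⟨m, r, q, d, h'⟩
    simp [hb] at h'
  | reemit m r q d r' _ _ hb _ h =>
    refine absurd ⟨⟨_, _, _, _, h⟩, ?_⟩ hc
    rintro ⟨m, r, q, d, h'⟩
    simp [hb] at h'
  | forward _ _ _ _ _ _ _ _ _ hb _ _ _ h =>
    refine absurd ⟨⟨_, _, _, _, h⟩, ?_⟩ hc
    rintro ⟨m, r, q, d, h'⟩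
    simp [hb] at h'
  | deliver m r q _ hb h => simp [hb, h, weight]
  | propagate m r q d r' c _ _ hb _ _ hS h =>
    cases c <;> simp_all [weight]
  | fail m r q d _ _ hb _ h => simp [hb, h, weight]
  | erase m r q d c _ hb hS _ _ _ h => cases c <;> simp_all [weight]

end Weight

namespace Execution

variable {V : Type u} {M : Type v} {G : SimpleGraph V}
  {A : RoutingAlgorithm.{u, w} G} {Γ : Execution A M}

/-! ### Messages emitted before the convergence of the routing algorithm -/

/-- The content of the buffer comes from a message present at time `t₀`, not emitted again
between `t₀` and `t₀ + n`. -/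
def Stale (Γ : Execution A M) (t₀ : ℕ) : ℕ → ℕ → V → Prop
  | 0, i, p => (Γ.conf t₀).buf p i ≠ none
  | n + 1, i, p =>
    -- A forwarded copy inherits staleness from its sender; a creation at rank 1 fails `2 ≤ i` and
    -- thus clears it.
    (Created (Γ.conf (t₀ + n)) (Γ.conf (t₀ + n + 1)) i p ∧ 2 ≤ i ∧
      ∃ m r q d, (Γ.conf (t₀ + n + 1)).buf p i = some ⟨m, r, q, d, .S⟩ ∧
        Stale Γ t₀ n (i - 1) q) ∨
    (¬ Created (Γ.conf (t₀ + n)) (Γ.conf (t₀ + n + 1)) i p ∧ Stale Γ t₀ n i p)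

theorem stale_succ_of_not_created {t₀ n i : ℕ} {p : V}
    (h : ¬ Created (Γ.conf (t₀ + n)) (Γ.conf (t₀ + n + 1)) i p) :
    Γ.Stale t₀ (n + 1) i p ↔ Γ.Stale t₀ n i p := by
  simp [Stale, h]

theorem stale_succ_of_created {t₀ n i : ℕ} {p : V} {m : M} {r q d : V} (hi : 1 ≤ i)
    (h : Created (Γ.conf (t₀ + n)) (Γ.conf (t₀ + n + 1)) (i + 1) p)
    (hb : (Γ.conf (t₀ + n + 1)).buf p (i + 1) = some ⟨m, r, q, d, .S⟩) :
    Γ.Stale t₀ (n + 1) (i + 1) p ↔ Γ.Stale t₀ n i q := by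
  constructor
  · rintro (⟨-, -, m', r', q', d', hb', hs⟩ | ⟨hn, -⟩)
    · rw [hb] at hb'
      cases hb'
      exact hs
    · exact absurd h hn
  · exact fun hs => Or.inl ⟨h, by omega, m, r, q, d, hb, hs⟩

/-- A message on a shortest path, of a rank which allows it to reach its destination. -/
def OnTrack (G : SimpleGraph V) (i : ℕ) (p : V) (x : Msg V M) : Prop :=
  x.type ≠ .F ∧ G.dist p x.dest + i ≤ G.diam + 1 ∧
    (p ≠ x.dest → G.dist x.next x.dest + 1 = G.dist p x.dest)

/-- An emission at rank 1 satisfies the distance bound because distances are at most D, and each hop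
on correct tables trades one unit of distance for one rank. The second clause, that a stale copy has
a stale parent, is carried along because it prevents a fresh message from receiving `F` from its
child. -/
theorem onTrack_of_not_stale [Finite V] (hG : G.Connected) (hD : 1 ≤ G.diam)
    (h0 : NoMessage (Γ.conf 0)) {t₀ : ℕ} (hconv : A.Converged (Γ.conf t₀).table) (n : ℕ) {i : ℕ} {p : V} {x : Msg V M}
    (h1 : 1 ≤ i) (h2 : i ≤ G.diam + 1) (hb : (Γ.conf (t₀ + n)).buf p i = some x) :
    (¬ Γ.Stale t₀ n i p → OnTrack G i p x) ∧
      ∀ j, i = j + 1 → 1 ≤ j → Γ.Stale t₀ n i p → Γ.Stale t₀ n j x.last := by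
  induction n generalizing i p x with
  | zero =>
    refine ⟨fun h => (h (by rw [Stale]; erw [hb]; simp)).elim, ?_⟩
    rintro j rfl hj -
    obtain ⟨-, q', c', hq, -⟩ := (linked hD h0 t₀).parent hj (by omega) hb
    simp [Stale, hq]
  | succ n ih =>
    obtain ⟨m, r, q, d, c⟩ := x
    set γ := Γ.conf (t₀ + n) with hγdef
    have hγ : Linked γ := linked hD h0 _
    have ht : BufTrans γ (Γ.conf (t₀ + n + 1)) := bufTrans hD h0 _
    -- A message that already has a child is never newly created, so its staleness is unchanged.
    have hnp : ∀ {j p m r q d c}, 1 ≤ j → j ≤ G.diam → γ.buf p (j + 1) = some ⟨m, r, q, d, c⟩ →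
        ¬ Created γ (Γ.conf (t₀ + n + 1)) j q := by
      rintro j p m r q d c hj hj' hbp ⟨⟨m', r', q', d', h⟩, hn⟩
      obtain ⟨-, q', c', hq, -⟩ := hγ.parent hj hj' hbp
      rcases hγ.parent_step ht hj hj' hbp hq with h' | ⟨rfl, -⟩
      · rw [h] at h'
        cases h'
        exact hn ⟨_, _, _, _, hq⟩
      · exact hn ⟨_, _, _, _, hq⟩
    have hpar : ∀ {c' : MsgType}, γ.buf p i = some ⟨m, r, q, d, c'⟩ →
        ¬ Created γ (Γ.conf (t₀ + n + 1)) i p →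
        ∀ j, i = j + 1 → 1 ≤ j → Γ.Stale t₀ (n + 1) i p → Γ.Stale t₀ (n + 1) j q := by
      rintro c' hbp hn j rfl hj hs
      exact (stale_succ_of_not_created (hnp hj (by omega) hbp)).2
        ((ih h1 h2 hbp).2 j rfl hj ((stale_succ_of_not_created hn).1 hs))
    have hhop : ∀ {d}, p ≠ d → G.dist (γ.hop p d) d + 1 = G.dist p d :=
      fun h => dist_hop hconv (by omega) h
    have hfirst : i = 1 → c = .S → (p ≠ d → r = γ.hop p d) → OnTrack G i p ⟨m, r, q, d, c⟩ := by
      rintro rfl rfl hr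
      have := hG.nonempty
      refine ⟨nofun, Nat.add_le_add_right (SimpleGraph.dist_le_diam
        (SimpleGraph.connected_iff_ediam_ne_top.1 hG)) 1, fun h => ?_⟩
      exact (hr h).symm ▸ hhop h
    rcases ht.type_step h1 h2 hb with h | ⟨hS, h⟩ | ⟨hS, hi, hr, -⟩ | ⟨hS, hi, hr, -⟩ |
      ⟨rfl, hr, hn, j, rfl, hj, hj', hqd, q', hq⟩
    · have hn : ¬ Created γ (Γ.conf (t₀ + n + 1)) i p := by
        rintro ⟨⟨m', r', q', d', h'⟩, hn⟩
        erw [hb] at h'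
        cases h'
        exact hn ⟨_, _, _, _, h⟩
      exact ⟨fun hs => (ih h1 h2 h).1 fun hs' => hs ((stale_succ_of_not_created hn).2 hs'),
        hpar h hn⟩
    · have hn : ¬ Created γ (Γ.conf (t₀ + n + 1)) i p := fun hn => hn.2 ⟨_, _, _, _, h⟩
      refine ⟨fun hs => ?_, hpar h hn⟩
      have hs' : ¬ Γ.Stale t₀ n i p := fun hs' => hs ((stale_succ_of_not_created hn).2 hs')
      obtain ⟨-, h3, h4⟩ := (ih h1 h2 h).1 hs'
      refine ⟨?_, h3, h4⟩
      rintro rfl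
      rcases ht p i h1 h2 with h5 | ⟨e, h5⟩
      · rw [h] at h5
        erw [hb] at h5
        cases h5
      · cases h5 with
        | generate _ _ _ _ _ h5 => simp [h] at h5
        | reemit _ _ _ _ _ _ _ h5 => simp [h] at h5
        | forward _ _ _ _ _ _ _ _ _ h5 => simp [h] at h5
        | deliver m r q _ _ h5 =>
          erw [hb] at h5
          cases h5
        | propagate m2 r2 q2 d2 r' c2 _ hi h5 hp hch _ h6 =>
          rw [h] at h5
          cases h5
          erw [hb] at h6
          cases h6
          have := ih (by omega) (by omega) hch
          -- A child of type `F` is stale by induction, hence so is the parent, which was assumed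
          -- fresh.
          exact (this.1 fun hs2 => hs' (this.2 i rfl h1 hs2)).1 rfl
        | fail m2 r2 q2 d2 _ hi h5 hd _ =>
          rw [h] at h5
          cases h5
          -- At rank D + 1 the distance bound leaves no room: the message is at its destination.
          have : G.dist p d = 0 := by
            simp only at h3
            omega
          exact hd ((hG.dist_eq_zero_iff).1 this).symm
        | erase _ _ _ _ _ _ h5 hS' =>
          rw [h] at h5
          cases h5
          exact hS' rfl
    · exact ⟨fun _ => hfirst hi hS fun _ => hr, fun j hj hj' => by omega⟩
    · exact ⟨fun _ => hfirst hi hS fun h => hr h.symm, fun j hj hj' => by omega⟩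
    · have hc : Created γ (Γ.conf (t₀ + n + 1)) (j + 1) p := by
        refine ⟨⟨_, _, _, _, hb⟩, ?_⟩
        rintro ⟨m', r', q', d', h'⟩
        rw [hn] at h'
        cases h'
      have hst := stale_succ_of_created hj hc hb
      refine ⟨fun hs => ?_, ?_⟩
      · obtain ⟨-, h3, h4⟩ := (ih hj (by omega) hq).1 fun hs' => hs (hst.2 hs')
        have := h4 hqd
        simp only at h3 this
        refine ⟨nofun, ?_, fun h => hr ▸ hhop h⟩
        simp only
        omega
      · rintro j' hj2 - hs
        obtain rfl : j' = j := by omega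
        refine (stale_succ_of_not_created ?_).2 (hst.1 hs)
        exact fun hn => hn.2 ⟨_, _, _, _, hq⟩

theorem not_stale_of_noMessage (h0 : NoMessage (Γ.conf 0)) (n : ℕ) {i : ℕ}
    (h1 : 1 ≤ i) (h2 : i ≤ G.diam + 1) (p : V) : ¬ Γ.Stale 0 n i p := by
  induction n generalizing i p with
  | zero => simp [Stale, h0 p i h1 h2]
  | succ n ih =>
    rintro (⟨-, h, m, r, q, d, -, h'⟩ | ⟨-, h'⟩)
    · exact ih (by omega) (by omega) q h'
    · exact ih h1 h2 p h'

/-- If the routing tables are correct from the beginning, all messages are on track. -/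
theorem onTrack [Finite V] (hG : G.Connected) (hD : 1 ≤ G.diam) (h0 : NoMessage (Γ.conf 0))
    (hconv : A.Converged (Γ.conf 0).table) {t i : ℕ} {p : V} {x : Msg V M} (h1 : 1 ≤ i)
    (h2 : i ≤ G.diam + 1) (hb : (Γ.conf t).buf p i = some x) : OnTrack G i p x :=
  (onTrack_of_not_stale hG hD h0 hconv t h1 h2 (by rwa [Nat.zero_add])).1
    (not_stale_of_noMessage h0 t h1 h2 p)

/-- A message gets the type `A` when it is delivered or by propagation. -/
theorem deliver_or_ackPropagated (hD : 1 ≤ G.diam) (h0 : NoMessage (Γ.conf 0)) {t i : ℕ} {p : V}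
    (hc : Acked (Γ.conf t) (Γ.conf (t + 1)) i p) :
    Γ.fired t p i = some .deliver ∨ AckPropagated (Γ.conf t) (Γ.conf (t + 1)) i p := by
  obtain ⟨⟨m, r, q, d, h⟩, hn⟩ := hc
  cases hf : Γ.fired t p i with
  | none =>
    rw [Γ.fired_idle t p i hf] at h
    exact absurd ⟨_, _, _, _, h⟩ hn
  | some e =>
    cases bufStep hD h0 hf with
    | deliver m r q he => exact Or.inl (he ▸ rfl)
    | propagate m r q d r' c _ hi hb hp hch hS h' =>
      rw [h] at h'
      cases h'
      exact Or.inr ⟨⟨_, _, _, _, h⟩, hi, _, _, _, _, _, hb, hch⟩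
    | generate _ _ _ _ _ _ h' => rw [h] at h'; cases h'
    | reemit _ _ _ _ _ _ _ _ _ h' => rw [h] at h'; cases h'
    | forward _ _ _ _ _ _ _ _ _ _ _ _ _ h' => rw [h] at h'; cases h'
    | fail _ _ _ _ _ _ _ _ h' => rw [h] at h'; cases h'
    | erase _ _ _ _ _ _ _ _ _ _ _ h' => rw [h] at h'; cases h'

/-! ### Counting actions -/

variable [Fintype V]

/-- The constant 3 pays for a creation: one for the rule itself and at most 2 for the weight it
leaves. -/
theorem weight_step (hD : 1 ≤ G.diam) (h0 : NoMessage (Γ.conf 0)) (t i : ℕ) :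
    ∑ p, weight ((Γ.conf (t + 1)).buf p i) + count (fun p => Γ.fired t p i ≠ none) ≤
      ∑ p, weight ((Γ.conf t).buf p i) +
        3 * count (Created (Γ.conf t) (Γ.conf (t + 1)) i) := by
  classical
  simp only [count, Finset.mul_sum, ← Finset.sum_add_distrib]
  refine Finset.sum_le_sum fun p _ => ?_
  obtain hf | ⟨e, hf⟩ := Option.eq_none_or_eq_some (Γ.fired t p i)
  · simp [hf, Γ.fired_idle t p i hf]
  · simp only [hf]
    by_cases hc : Created (Γ.conf t) (Γ.conf (t + 1)) i p
    · have := weight_le_two ((Γ.conf (t + 1)).buf p i)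
      simp only [ne_eq, reduceCtorEq, not_false_eq_true, if_true, hc]
      omega
    · have := (bufStep hD h0 hf).weight_lt hc
      simp [hc, this]

theorem sum_fired_le (hD : 1 ≤ G.diam) (h0 : NoMessage (Γ.conf 0)) {t₀ T : ℕ} (hT : t₀ ≤ T)
    (i : ℕ) :
    ∑ t ∈ Finset.Ico t₀ T, count (fun p => Γ.fired t p i ≠ none) ≤
      3 * (count (fun p => (Γ.conf t₀).buf p i ≠ none) +
        ∑ t ∈ Finset.Ico t₀ T, count (Created (Γ.conf t) (Γ.conf (t + 1)) i)) := by
  classical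
  have h := add_sum_Ico_le (f := fun t => ∑ p, weight ((Γ.conf t).buf p i))
    (a := fun t => count (fun p => Γ.fired t p i ≠ none))
    (b := fun t => 3 * count (Created (Γ.conf t) (Γ.conf (t + 1)) i))
    (fun t _ => weight_step hD h0 t i) hT
  rw [← Finset.mul_sum] at h
  have h' : ∑ p, weight ((Γ.conf t₀).buf p i) ≤
      3 * count (fun p => (Γ.conf t₀).buf p i ≠ none) := by
    rw [count, Finset.mul_sum]
    refine Finset.sum_le_sum fun p _ => ?_
    cases hb : (Γ.conf t₀).buf p i with
    | none => simp [weight]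
    | some x =>
      have := weight_le_two (some x)
      simp only [ne_eq, reduceCtorEq, not_false_eq_true, if_true]
      omega
  omega

/-- Rank by rank, copies present or created at rank i + 1 are charged to distinct messages present
or created at rank i. The readiness at `t₀` left over from the step inequality is absorbed by the
occupied buffers of rank i without a child. -/
theorem count_add_sum_created_le (hD : 1 ≤ G.diam) (h0 : NoMessage (Γ.conf 0)) {t₀ T : ℕ}
    (hT : t₀ ≤ T) {i : ℕ} (h1 : 1 ≤ i) (h2 : i ≤ G.diam + 1) :
    count (fun p => (Γ.conf t₀).buf p i ≠ none) +
        ∑ t ∈ Finset.Ico t₀ T, count (Created (Γ.conf t) (Γ.conf (t + 1)) i) ≤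
      count (fun p => (Γ.conf t₀).buf p 1 ≠ none) +
        ∑ t ∈ Finset.Ico t₀ T, count (Created (Γ.conf t) (Γ.conf (t + 1)) 1) := by
  induction i, h1 using Nat.le_induction with
  | base => exact le_rfl
  | succ i h1 ih =>
    have hb := (linked hD h0 t₀).count_add_count_ready_le h1 (by omega)
    have hs := add_sum_Ico_le (f := fun t => count (Ready (Γ.conf t) i))
      (a := fun t => count (Created (Γ.conf t) (Γ.conf (t + 1)) (i + 1)))
      (b := fun t => count (Created (Γ.conf t) (Γ.conf (t + 1)) i)) (fun t (_ : t₀ ≤ t) =>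
      (linked hD h0 t).count_created_step (bufTrans hD h0 t) h1 (by omega)) hT
    have := ih (by omega)
    omega

theorem card_activeAt_le (hD : 1 ≤ G.diam) (h0 : NoMessage (Γ.conf 0)) {t₀ T : ℕ}
    (hT : t₀ ≤ T) [DecidablePred Γ.ActiveAt] :
    ((Finset.Ico t₀ T).filter Γ.ActiveAt).card ≤
      3 * (G.diam + 1) * (count (fun p => (Γ.conf t₀).buf p 1 ≠ none) +
        ∑ t ∈ Finset.Ico t₀ T, count (Created (Γ.conf t) (Γ.conf (t + 1)) 1)) := by
  have h : ((Finset.Ico t₀ T).filter Γ.ActiveAt).card ≤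
      ∑ i ∈ Finset.Icc 1 (G.diam + 1), ∑ t ∈ Finset.Ico t₀ T,
        count (fun p => Γ.fired t p i ≠ none) := by
    rw [Finset.sum_comm, Finset.card_filter]
    refine Finset.sum_le_sum fun t _ => ?_
    split_ifs with ha
    · obtain ⟨p, i, hf⟩ := ha
      have hi := fired_rank hf
      exact (one_le_count (P := fun p => Γ.fired t p i ≠ none) hf).trans (Finset.single_le_sum
        (f := fun i => count (fun p : V => Γ.fired t p i ≠ none)) (fun _ _ => Nat.zero_le _)
        (Finset.mem_Icc.2 hi))
    · exact Nat.zero_le _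
  refine (h.trans (Finset.sum_le_card_nsmul _ _ _ fun i hi => ?_)).trans_eq
    (b := (Finset.Icc 1 (G.diam + 1)).card • (3 * (count (fun p => (Γ.conf t₀).buf p 1 ≠ none) +
        ∑ t ∈ Finset.Ico t₀ T, count (Created (Γ.conf t) (Γ.conf (t + 1)) 1)))) ?_
  · rw [Finset.mem_Icc] at hi
    exact (sum_fired_le hD h0 hT i).trans
      (Nat.mul_le_mul_left 3 (count_add_sum_created_le hD h0 hT hi.1 hi.2))
  · rw [Nat.card_Icc, smul_eq_mul, Nat.add_sub_cancel]
    ring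

/-- The number of messages generated in step `t`. -/
noncomputable def generatedAt (Γ : Execution A M) (t : ℕ) : ℕ :=
  count fun p => Γ.fired t p 1 = some .generate

/-- A message of type `F` is emitted again in step `t`. -/
def Reemits (Γ : Execution A M) (t : ℕ) (p : V) : Prop :=
  HasType (Γ.conf t) .F 1 p ∧ HasType (Γ.conf (t + 1)) .S 1 p

theorem count_created_one_le (hD : 1 ≤ G.diam) (h0 : NoMessage (Γ.conf 0)) (t : ℕ) :
    count (Created (Γ.conf t) (Γ.conf (t + 1)) 1) ≤ Γ.generatedAt t + count (Γ.Reemits t) := by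
  classical
  simp only [generatedAt, count, ← Finset.sum_add_distrib]
  refine Finset.sum_le_sum fun p _ => ?_
  by_cases hc : Created (Γ.conf t) (Γ.conf (t + 1)) 1 p
  · have : Γ.fired t p 1 = some .generate ∨ Γ.Reemits t p := by
      cases hf : Γ.fired t p 1 with
      | none =>
        obtain ⟨⟨m, r, q, d, h⟩, hn⟩ := hc
        rw [Γ.fired_idle t p 1 hf] at h
        exact absurd ⟨_, _, _, _, h⟩ hn
      | some e =>
        cases bufStep hD h0 hf with
        | generate m d r he => exact Or.inl (he ▸ rfl)
        | reemit m r q d r' _ _ hb _ h => exact Or.inr ⟨⟨_, _, _, _, hb⟩, ⟨_, _, _, _, h⟩⟩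
        | forward j _ _ _ _ _ hj hj' => omega
        | deliver m r q _ hb h => exact absurd ⟨_, _, _, _, hb⟩ hc.2
        | propagate m r q d r' c _ _ hb => exact absurd ⟨_, _, _, _, hb⟩ hc.2
        | fail m r q d _ _ hb => exact absurd ⟨_, _, _, _, hb⟩ hc.2
        | erase m r q d c _ hb hS _ _ _ h =>
          obtain ⟨m, r, q, d, h'⟩ := hc.1
          rw [h] at h'
          cases h'
    rcases this with h | h <;> simp [h, hc]
  · simp [hc]

theorem count_root_step (hD : 1 ≤ G.diam) (h0 : NoMessage (Γ.conf 0)) (t : ℕ) :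
    count (fun p => (Γ.conf (t + 1)).buf p 1 ≠ none) ≤
      count (fun p => (Γ.conf t).buf p 1 ≠ none) + Γ.generatedAt t := by
  classical
  simp only [generatedAt, count, ← Finset.sum_add_distrib]
  refine Finset.sum_le_sum fun p _ => ?_
  by_cases hn : (Γ.conf t).buf p 1 = none
  · obtain hf | ⟨e, hf⟩ := Option.eq_none_or_eq_some (Γ.fired t p 1)
    · simp [hn, Γ.fired_idle t p 1 hf]
    · cases bufStep hD h0 hf with
      | generate m d r he =>
        rw [if_pos (hf.trans (congrArg some he))]
        split_ifs <;> omega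
      | forward j _ _ _ _ _ hj hj' => omega
      | reemit _ _ _ _ _ _ _ hb => simp [hn] at hb
      | deliver _ _ _ _ hb => simp [hn] at hb
      | propagate _ _ _ _ _ _ _ _ hb => simp [hn] at hb
      | fail _ _ _ _ _ _ hb => simp [hn] at hb
      | erase _ _ _ _ _ _ hb => simp [hn] at hb
  · rw [if_pos hn]
    split_ifs <;> omega

theorem count_root_le (hD : 1 ≤ G.diam) (h0 : NoMessage (Γ.conf 0)) (t : ℕ) :
    count (fun p => (Γ.conf t).buf p 1 ≠ none) ≤ ∑ s ∈ Finset.range t, Γ.generatedAt s := by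
  induction t with
  | zero => simp [count, h0 _ 1 le_rfl (by omega)]
  | succ t ih =>
    rw [Finset.sum_range_succ]
    have := count_root_step hD h0 t
    omega

/-- Only stale messages can have type `F`, and re-emission clears the staleness of the root. Stale
roots therefore never increase in number and lose one at each re-emission. -/
theorem sum_count_reemits_le (hG : G.Connected) (hD : 1 ≤ G.diam) (h0 : NoMessage (Γ.conf 0))
    {t₀ : ℕ} (hconv : A.Converged (Γ.conf t₀).table) {T : ℕ} (hT : t₀ ≤ T) :
    ∑ t ∈ Finset.Ico t₀ T, count (Γ.Reemits t) ≤
      count fun p => (Γ.conf t₀).buf p 1 ≠ none := by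
  classical
  have h := add_sum_Ico_le (f := fun t => count (Γ.Stale t₀ (t - t₀) 1))
    (a := fun t => count (Γ.Reemits t)) (b := fun _ => 0) (fun t ht => ?_) hT
  · simp only [Nat.sub_self, Finset.sum_const_zero, Nat.add_zero] at h
    exact (Nat.le_add_left _ _).trans h
  · obtain ⟨n, rfl⟩ := Nat.exists_eq_add_of_le ht
    have e1 : t₀ + n + 1 - t₀ = n + 1 := by omega
    simp only [e1, Nat.add_sub_cancel_left, Nat.add_zero, count, ← Finset.sum_add_distrib]
    refine Finset.sum_le_sum fun p _ => ?_
    by_cases hr : Γ.Reemits (t₀ + n) p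
    · have hc : Created (Γ.conf (t₀ + n)) (Γ.conf (t₀ + n + 1)) 1 p :=
        ⟨hr.2, fun h => nomatch h.unique hr.1⟩
      have hs : Γ.Stale t₀ n 1 p := by
        by_contra hs
        obtain ⟨m, r, q, d, hF⟩ := hr.1
        exact ((onTrack_of_not_stale hG hD h0 hconv n le_rfl (by omega) hF).1 hs).1 rfl
      have hs' : ¬ Γ.Stale t₀ (n + 1) 1 p := by simp [Stale, hc]
      simp [hs, hs', hr]
    · by_cases hs : Γ.Stale t₀ (n + 1) 1 p
      · have : Γ.Stale t₀ n 1 p := by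
          rcases hs with ⟨_, h, _⟩ | ⟨_, h⟩
          · omega
          · exact h
        simp [hs, hr, this]
      · simp [hs, hr]

theorem card_activeAt_le_sum_generatedAt (hG : G.Connected) (hD : 1 ≤ G.diam)
    (h0 : NoMessage (Γ.conf 0)) {t₀ T : ℕ} (hconv : A.Converged (Γ.conf t₀).table) (hT : t₀ ≤ T)
    [DecidablePred Γ.ActiveAt] :
    ((Finset.Ico t₀ T).filter Γ.ActiveAt).card ≤
      6 * (G.diam + 1) * ∑ t ∈ Finset.range T, Γ.generatedAt t := by
  have h1 := card_activeAt_le hD h0 hT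
  have h2 := sum_count_reemits_le hG hD h0 hconv hT
  have h3 := count_root_le hD h0 t₀
  have h4 := Finset.sum_le_sum fun t (_ : t ∈ Finset.Ico t₀ T) => count_created_one_le hD h0 t
  rw [Finset.sum_add_distrib] at h4
  have h5 := Finset.sum_range_add_sum_Ico Γ.generatedAt hT
  refine h1.trans ?_
  -- The factor 2: messages present at rank 1 at time `t₀` are counted once for their presence and
  -- once for their possible re-emission, and all were generated before `t₀`.
  rw [show 6 * (G.diam + 1) = 3 * (G.diam + 1) * 2 by ring, Nat.mul_assoc (3 * (G.diam + 1))]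
  refine Nat.mul_le_mul_left _ ?_
  omega

/-! ### Generated and delivered messages -/

theorem count_acked_le (hD : 1 ≤ G.diam) (h0 : NoMessage (Γ.conf 0)) (t i : ℕ) :
    count (Acked (Γ.conf t) (Γ.conf (t + 1)) i) ≤
      count (fun p => Γ.fired t p i = some .deliver) +
        count (AckPropagated (Γ.conf t) (Γ.conf (t + 1)) i) := by
  classical
  simp only [count, ← Finset.sum_add_distrib]
  refine Finset.sum_le_sum fun p _ => ?_
  by_cases hc : Acked (Γ.conf t) (Γ.conf (t + 1)) i p
  · rcases deliver_or_ackPropagated hD h0 hc with h | h <;> simp [h, hc]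
  · simp [hc]

/-- Descending induction on the rank: an acknowledgment is born by delivery or propagated from a
distinct one of the next rank, and initially none is waiting. -/
theorem sum_acked_le (hD : 1 ≤ G.diam) (h0 : NoMessage (Γ.conf 0)) (T k : ℕ) {i : ℕ} (h1 : 1 ≤ i)
    (h2 : i + k = G.diam + 1) :
    ∑ t ∈ Finset.range T, count (Acked (Γ.conf t) (Γ.conf (t + 1)) i) ≤
      ∑ j ∈ Finset.Icc i (G.diam + 1), ∑ t ∈ Finset.range T,
        count (fun p => Γ.fired t p j = some .deliver) := by
  have hsum := Finset.sum_le_sum fun t (_ : t ∈ Finset.range T) =>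
    count_acked_le hD h0 t i
  rw [Finset.sum_add_distrib] at hsum
  induction k generalizing i with
  | zero =>
    obtain rfl : i = G.diam + 1 := h2
    rw [Finset.Icc_self, Finset.sum_singleton]
    refine hsum.trans_eq ?_
    simp only [Nat.add_eq_left]
    refine Finset.sum_eq_zero fun t _ => count_eq_zero fun p hp => ?_
    exact absurd hp.2.1 (by omega)
  | succ k ih =>
    have h3 := ih (i := i + 1) (by omega) (by omega) (by
      rw [← Finset.sum_add_distrib]
      exact Finset.sum_le_sum fun t _ => count_acked_le hD h0 t (i + 1))
    have h4 := add_sum_Ico_le (f := fun t => count (Waiting (Γ.conf t) i))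
      (a := fun t => count (AckPropagated (Γ.conf t) (Γ.conf (t + 1)) i))
      (b := fun t => count (Acked (Γ.conf t) (Γ.conf (t + 1)) (i + 1))) (fun t (_ : 0 ≤ t) =>
      (linked hD h0 t).count_ackPropagated_step (bufTrans hD h0 t) h1 (by omega)) (Nat.zero_le T)
    have h5 : count (Waiting (Γ.conf 0) i) = 0 := count_eq_zero fun p hp => by
      obtain ⟨m, r, q, d, q', h, -⟩ := hp
      simp [h0 p (i + 1) (by omega) (by omega)] at h
    rw [← Finset.range_eq_Ico] at h4
    rw [← Finset.add_sum_Ioc_eq_sum_Icc (by omega), ← Finset.Icc_add_one_left_eq_Ioc]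
    omega

theorem delivered_eq (T : ℕ) : Γ.delivered T = ∑ j ∈ Finset.Icc 1 (G.diam + 1),
    ∑ t ∈ Finset.range T, count (fun p => Γ.fired t p j = some .deliver) := by
  classical
  rw [delivered, Finset.sum_comm (s := Finset.Icc 1 (G.diam + 1))]
  refine Finset.sum_congr rfl fun t _ => ?_
  rw [Finset.sum_comm]
  refine Finset.sum_congr rfl fun i _ => Finset.sum_congr rfl fun p _ => ?_
  split_ifs <;> rfl

/-- At rank 1 only `A` is erased, so a generated message stays pending, through any re-emission,
until it is acknowledged. -/
theorem generated_root_step (hD : 1 ≤ G.diam) (h0 : NoMessage (Γ.conf 0)) (t : ℕ) :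
    count (fun p => (Γ.conf t).buf p 1 ≠ none ∧ ¬ HasType (Γ.conf t) .A 1 p) + Γ.generatedAt t ≤
      count (fun p => (Γ.conf (t + 1)).buf p 1 ≠ none ∧ ¬ HasType (Γ.conf (t + 1)) .A 1 p) +
        count (Acked (Γ.conf t) (Γ.conf (t + 1)) 1) := by
  classical
  simp only [generatedAt, count, ← Finset.sum_add_distrib]
  refine Finset.sum_le_sum fun p _ => ?_
  have hnot : ∀ {γ : Config A M} {m r q d c}, γ.buf p 1 = some ⟨m, r, q, d, c⟩ →
      (HasType γ .A 1 p ↔ c = .A) := fun hb =>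
    ⟨fun ⟨m', r', q', d', h⟩ => by rw [hb] at h; cases h; rfl, fun h => ⟨_, _, _, _, h ▸ hb⟩⟩
  obtain hf | ⟨e, hf⟩ := Option.eq_none_or_eq_some (Γ.fired t p 1)
  · have h := Γ.fired_idle t p 1 hf
    have : HasType (Γ.conf (t + 1)) .A 1 p ↔ HasType (Γ.conf t) .A 1 p := by
      simp only [HasType, h]
    simp only [h, this, hf, reduceCtorEq, if_false, Nat.add_zero]
    split_ifs <;> omega
  · simp only [hf]
    cases bufStep hD h0 hf with
    | generate m d r he _ hb h => simp [he, hb, h, hnot h]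
    | forward j _ _ _ _ _ hj hj' => omega
    | reemit _ _ _ _ _ he _ hb _ h => simp [he, hb, h, hnot h, hnot hb]
    | deliver _ _ _ he hb h => simp [he, hb, h, Acked, hnot h, hnot hb]
    | propagate _ _ _ _ _ c he _ hb _ _ _ h => cases c <;> simp [he, hb, h, Acked, hnot h, hnot hb]
    | fail _ _ _ _ he _ hb _ h => simp [he, hb, h, Acked, hnot h, hnot hb]
    | erase _ _ _ _ c he hb _ hA _ _ h =>
      obtain rfl := hA rfl
      simp [he, hb, h, Acked, hnot hb]

/-- A message at rank `1` which is not of type `A` has not been delivered; the other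
generated messages have. -/
theorem sum_generatedAt_le (hD : 1 ≤ G.diam) (h0 : NoMessage (Γ.conf 0)) (T : ℕ) :
    ∑ t ∈ Finset.range T, Γ.generatedAt t ≤ Γ.delivered T +
      count (fun p => (Γ.conf T).buf p 1 ≠ none ∧ ¬ HasType (Γ.conf T) .A 1 p) := by
  have h1 := sum_acked_le hD h0 T G.diam le_rfl (by omega)
  rw [← delivered_eq] at h1
  suffices ∑ t ∈ Finset.range T, Γ.generatedAt t ≤
      count (fun p => (Γ.conf T).buf p 1 ≠ none ∧ ¬ HasType (Γ.conf T) .A 1 p) +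
        ∑ t ∈ Finset.range T, count (Acked (Γ.conf t) (Γ.conf (t + 1)) 1) by omega
  clear h1
  induction T with
  | zero => simp
  | succ T ih =>
    rw [Finset.sum_range_succ, Finset.sum_range_succ]
    have := generated_root_step hD h0 T
    omega

end Execution

namespace Execution

/-! ### The amortized bound -/

section Amortized

variable {V : Type u} [Fintype V] {M : Type v} {G : SimpleGraph V}
  {A : RoutingAlgorithm.{u, w} G} {Γ : Execution A M}

theorem delivered_mono : Monotone Γ.delivered := fun _ _ h =>
  Finset.sum_le_sum_of_subset (Finset.range_mono h)

theorem one_le_sum_generatedAt (hgen : Γ.GeneratesSome) :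
    ∃ T₀, ∀ T, T₀ ≤ T → 1 ≤ ∑ t ∈ Finset.range T, Γ.generatedAt t := by
  obtain ⟨t, p, i, hf⟩ := hgen
  have hi : i = 1 := by
    have h := Γ.fired_rule t p i _ hf
    generalize (Γ.conf (t + 1)).buf p i = b at h
    cases h
    rfl
  subst hi
  refine ⟨t + 1, fun T hT => ?_⟩
  exact (one_le_count (P := fun p => Γ.fired t p 1 = some .generate) hf).trans
    (Finset.single_le_sum (f := Γ.generatedAt) (fun _ _ => Nat.zero_le _)
      (Finset.mem_range.2 hT))

theorem exists_not_activeAt (hG : G.Connected) (hD : 1 ≤ G.diam) (h0 : NoMessage (Γ.conf 0))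
    {t₀ : ℕ} (hconv : A.Converged (Γ.conf t₀).table) {K : ℕ}
    (hK : ∀ T, ∑ t ∈ Finset.range T, Γ.generatedAt t ≤ K) :
    ∃ T₀, ∀ t, T₀ ≤ t → ¬ Γ.ActiveAt t := by
  classical
  by_contra! hinf
  have hinf' : {t | t₀ ≤ t ∧ Γ.ActiveAt t}.Infinite :=
    Set.infinite_of_not_bddAbove fun ⟨B, hB⟩ => by
      obtain ⟨t, ht, ha⟩ := hinf (max t₀ (B + 1))
      have := hB (show t ∈ {t | t₀ ≤ t ∧ Γ.ActiveAt t} from ⟨by omega, ha⟩)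
      omega
  obtain ⟨F, hF, hcard⟩ := hinf'.exists_subset_card_eq (6 * (G.diam + 1) * K + 1)
  have hle : F.card ≤ ((Finset.Ico t₀ (max t₀ (F.sup id + 1))).filter Γ.ActiveAt).card := by
    refine Finset.card_le_card fun t ht => ?_
    obtain ⟨h1, h2⟩ := hF ht
    have : t ≤ F.sup id := Finset.le_sup (f := id) ht
    exact Finset.mem_filter.2 ⟨Finset.mem_Ico.2 ⟨h1, by omega⟩, h2⟩
  have h1 := card_activeAt_le_sum_generatedAt hG hD h0 hconv (le_max_left t₀ (F.sup id + 1))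
  have h2 := Nat.mul_le_mul_left (6 * (G.diam + 1)) (hK (max t₀ (F.sup id + 1)))
  omega

/-- At most n roots are pending. Beyond n deliveries the factor 2 covers them; if that number is
never exceeded, at most 2n messages are generated, activity ceases, and the network empties, so no
root is pending. -/
theorem exists_sum_generatedAt_le (hG : G.Connected) (hD : 1 ≤ G.diam)
    (h0 : NoMessage (Γ.conf 0)) (hfair : Γ.Fair) (hgen : Γ.GeneratesSome) {t₀ : ℕ}
    (hconv : A.Converged (Γ.conf t₀).table) :
    ∃ T₀, ∀ T, T₀ ≤ T → 1 ≤ Γ.delivered T ∧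
      ∑ t ∈ Finset.range T, Γ.generatedAt t ≤ 2 * Γ.delivered T := by
  have hle := sum_generatedAt_le hD h0
  by_cases hbdd : ∃ T, Fintype.card V + 1 ≤ Γ.delivered T
  · obtain ⟨T₀, hT₀⟩ := hbdd
    refine ⟨T₀, fun T hT => ?_⟩
    have h1 := hle T
    have h2 := delivered_mono (Γ := Γ) hT
    have h3 := count_le_card
      (fun p => (Γ.conf T).buf p 1 ≠ none ∧ ¬ HasType (Γ.conf T) .A 1 p)
    omega
  · push Not at hbdd
    obtain ⟨T₁, hT₁⟩ := exists_not_activeAt hG hD h0 hconv (K := 2 * Fintype.card V) fun T => by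
      have h1 := hle T
      have h2 := hbdd T
      have h3 := count_le_card
        (fun p => (Γ.conf T).buf p 1 ≠ none ∧ ¬ HasType (Γ.conf T) .A 1 p)
      omega
    obtain ⟨T₂, hT₂⟩ := one_le_sum_generatedAt hgen
    refine ⟨max t₀ (max T₁ T₂), fun T hT => ?_⟩
    have h1 := hle T
    have h2 := hT₂ T (by omega)
    have hempty := noMessage_of_not_activeAt hD h0 hfair (converged_mono hconv (by omega : t₀ ≤ T))
      fun s hs => hT₁ s (by omega)
    rw [count_eq_zero fun p hp => hp.1 (hempty p 1 le_rfl (by omega))] at h1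
    omega

theorem rounds_le (hG : G.Connected) (hD : 1 ≤ G.diam) (h0 : NoMessage (Γ.conf 0))
    (hfair : Γ.Fair) {R : ℕ} (hA : A.StabilizesWithin R) {T : ℕ}
    (hT : roundBoundary Γ.Enabled Γ.Acts 0 R ≤ T) :
    Γ.rounds T ≤ R + 6 * (G.diam + 1) * ∑ t ∈ Finset.range T, Γ.generatedAt t := by
  classical
  have hconv := converged_of_stabilizes hA hfair
  refine (roundCount_le hfair R Γ.ActiveAt (fun t ht ⟨p, hp⟩ =>
    exists_activeAt_of_enabled hD h0 hfair (converged_mono hconv ht) hp) T).trans ?_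
  exact Nat.add_le_add_left (card_activeAt_le_sum_generatedAt hG hD h0 hconv hT) R

theorem amortizedComplexity_le (hG : G.Connected) (h0 : NoMessage (Γ.conf 0))
    (hfair : Γ.Fair) (hgen : Γ.GeneratesSome) {R : ℕ} (hA : A.StabilizesWithin R) :
    Γ.amortizedComplexity ≤ ((25 : ℕ) : ℝ≥0∞) * ((max R G.diam : ℕ) : ℝ≥0∞) := by
  have hD := one_le_diam hG Γ
  obtain ⟨T₀, hT₀⟩ := exists_sum_generatedAt_le hG hD h0 hfair hgen
    (converged_of_stabilizes hA hfair)
  refine Filter.limsup_le_of_le (by isBoundedDefault) ?_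
  filter_upwards [Filter.eventually_ge_atTop T₀,
    Filter.eventually_ge_atTop (roundBoundary Γ.Enabled Γ.Acts 0 R)] with T h1 h2
  obtain ⟨h3, h4⟩ := hT₀ T h1
  have h5 := rounds_le hG hD h0 hfair hA h2
  refine ENNReal.div_le_of_le_mul ?_
  norm_cast
  -- With D + 1 ≤ 2 max(R, D) the second term contributes 6 · 2 · 2 = 24; the first contributes 1,
  -- as at least one message has been delivered.
  calc Γ.rounds T ≤ R + 6 * (G.diam + 1) * (2 * Γ.delivered T) :=
        h5.trans (Nat.add_le_add_left (Nat.mul_le_mul_left _ h4) R)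
    _ ≤ max R G.diam * Γ.delivered T + 6 * (2 * max R G.diam) * (2 * Γ.delivered T) := by
        gcongr
        · exact (le_max_left R G.diam).trans (Nat.le_mul_of_pos_right _ h3)
        · have := le_max_right R G.diam
          omega
    _ = 25 * max R G.diam * Γ.delivered T := by ring

end Amortized

end Execution

/-! ### Ends of `S` chains -/

section Head

variable {V : Type u} {M : Type v} {G : SimpleGraph V} {A : RoutingAlgorithm.{u, w} G}

/-- The last buffer of a caterpillar of type `S`. -/
def Head (γ : Config A M) (i : ℕ) (p : V) : Prop :=
  ∃ m r q d, γ.buf p i = some ⟨m, r, q, d, .S⟩ ∧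
    (i ≤ G.diam → ¬ ∃ r' c, γ.buf r (i + 1) = some ⟨m, r', p, d, c⟩)

theorem HasSCaterpillar.exists_head {γ : Config A M} (hγ : Linked γ) (h : HasSCaterpillar γ) :
    ∃ i p, 1 ≤ i ∧ i ≤ G.diam + 1 ∧ Head γ i p := by
  obtain ⟨m, d, i, t, p, c, ⟨⟨h1, h2, h3, h4, h5, -⟩, hmax⟩, hS⟩ := h
  obtain ⟨l, rfl⟩ : ∃ l, t = l + 1 := ⟨t - 1, by omega⟩
  refine ⟨i + l, p l, by omega, by omega, ?_⟩
  obtain ⟨r, q, hb, -, hq⟩ := h5 l (by omega)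
  rw [hS l (by omega)] at hb
  refine ⟨m, r, q, d, hb, ?_⟩
  rintro hi ⟨r', c', hr⟩
  have hpd := (hγ.parent (by omega) hi hr).1
  have hadj := hγ.adj (by omega) (by omega) hb
  -- A child of the last buffer would extend the chain, against maximality; the invariant supplies
  -- the conditions on processors, and any type of the child fits.
  have key := hmax i (l + 2) (fun j => if j ≤ l then p j else r)
    (fun j => if j ≤ l then .S else c') ?_ le_rfl (by omega) (fun j hj => by
      rw [Nat.sub_self, Nat.zero_add, if_pos (by omega)])
  · omega
  refine ⟨h1, by omega, by omega, fun j hj => ?_, fun j hj => ?_, ?_⟩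
  · simp only [if_pos (show j ≤ l by omega)]
    rcases Nat.lt_or_ge j l with hjl | hjl
    · rw [if_pos (by omega)]
      exact h4 j (by omega)
    · obtain rfl : j = l := by omega
      rw [if_neg (by omega)]
      exact ⟨hpd, hadj.ne'⟩
  · rcases Nat.lt_or_ge j l with hjl | hjl
    · obtain ⟨r2, q2, hb2, h6, h7⟩ := h5 j (by omega)
      simp only [if_pos (show j ≤ l by omega)]
      refine ⟨r2, q2, hS j (by omega) ▸ hb2, fun _ => ?_, fun hj' => ?_⟩
      · rw [if_pos (by omega)]
        exact h6 (by omega)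
      · rw [if_pos (by omega)]
        exact h7 hj'
    · rcases hjl.eq_or_lt with rfl | hjl
      · simp only [le_refl, if_true]
        refine ⟨r, q, hb, fun _ => ?_, fun hj' => ?_⟩
        · rw [if_neg (by omega)]
        · rw [if_pos (by omega)]
          exact hq hj'
      · obtain rfl : j = l + 1 := by omega
        simp only [if_neg (show ¬ l + 1 ≤ l by omega)]
        refine ⟨r', p l, hr, fun h => by omega, fun _ => ?_⟩
        rw [Nat.add_sub_cancel, if_pos le_rfl]
  · cases c' with
    | S => exact ⟨l + 2, le_rfl, fun j _ => by simp, Or.inl fun j _ _ => by omega⟩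
    | A =>
      exact ⟨l + 1, by omega, fun j hj => if_pos (by omega),
        Or.inl fun j _ _ => if_neg (by omega)⟩
    | F =>
      exact ⟨l + 1, by omega, fun j hj => if_pos (by omega),
        Or.inr fun j _ _ => if_neg (by omega)⟩

/-- If all messages of rank at least `2` have type `S`, then a message of type `S` belongs to
a caterpillar of type `S`. -/
theorem exists_head_of_type_S {γ : Config A M}
    (h : ∀ i p m r q d c, 1 ≤ i → i ≤ G.diam → γ.buf p (i + 1) = some ⟨m, r, q, d, c⟩ → c = .S)
    (k : ℕ) {i : ℕ} {p : V} (h1 : 1 ≤ i) (hik : i + k = G.diam + 1) (hS : HasType γ .S i p) :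
    ∃ i' p', i ≤ i' ∧ i' ≤ G.diam + 1 ∧ Head γ i' p' := by
  induction k generalizing i p with
  | zero =>
    obtain ⟨m, r, q, d, hb⟩ := hS
    exact ⟨i, p, le_rfl, by omega, m, r, q, d, hb, fun h => by omega⟩
  | succ k ih =>
    obtain ⟨m, r, q, d, hb⟩ := hS
    by_cases hc : ∃ r' c, γ.buf r (i + 1) = some ⟨m, r', p, d, c⟩
    · obtain ⟨r', c, hr⟩ := hc
      obtain rfl := h i r _ _ _ _ _ h1 (by omega) hr
      obtain ⟨i', p', h2, h3⟩ := ih (i := i + 1) (p := r) (by omega) (by omega) ⟨_, _, _, _, hr⟩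
      exact ⟨i', p', by omega, h3⟩
    · exact ⟨i, p, le_rfl, by omega, m, r, q, d, hb, fun _ => hc⟩

/-- A message just created is the last one of its caterpillar. -/
theorem Linked.head_of_empty {γ γ' : Config A M} (hγ : Linked γ) (ht : BufTrans γ γ') {i : ℕ}
    {p : V} (h1 : 1 ≤ i) (hn : γ.buf p i = none) (hS : HasType γ' .S i p) : Head γ' i p := by
  obtain ⟨m, r, q, d, hb⟩ := hS
  refine ⟨m, r, q, d, hb, ?_⟩
  rintro hi ⟨r', c, hr⟩
  have hno := hγ.no_child_of_empty h1 hi hn r m d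
  rcases ht.type_step (by omega) (by omega) hr with h | ⟨_, h⟩ | ⟨_, h, _⟩ | ⟨_, h, _⟩ |
    ⟨_, _, _, j, hj, _, _, _, q', hq⟩
  · exact hno ⟨_, _, h⟩
  · exact hno ⟨_, _, h⟩
  · omega
  · omega
  · obtain rfl : i = j := by omega
    rw [hn] at hq
    cases hq

end Head

namespace Execution

/-! ### Progress without delivery, on correct tables -/

section Progress

variable {V : Type u} {M : Type v} {G : SimpleGraph V}
  {A : RoutingAlgorithm.{u, w} G} {Γ : Execution A M}

/-- Any rule either creates an `S` message or lowers the weight, so it changes the content. -/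
theorem buf_succ_ne_of_fired (hD : 1 ≤ G.diam) (h0 : NoMessage (Γ.conf 0)) {s i : ℕ} {p : V}
    (hf : Γ.fired s p i ≠ none) : (Γ.conf (s + 1)).buf p i ≠ (Γ.conf s).buf p i := by
  intro h
  obtain ⟨e, he⟩ := Option.ne_none_iff_exists'.1 hf
  have hlt := (bufStep hD h0 he).weight_lt (γ' := Γ.conf (s + 1)) fun hc => by
    obtain ⟨⟨m, r, q, d, h1⟩, h2⟩ := hc
    exact h2 ⟨m, r, q, d, h ▸ h1⟩
  rw [h] at hlt
  omega

variable [Finite V]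

/-- If a rule on a buffer remains enabled as long as the buffer does not change, then it changes
before the end of the round. -/
theorem exists_fired (hfair : Γ.Fair) (hsim : Γ.Simultaneous)
    (hconv : A.Converged (Γ.conf 0).table) {b i : ℕ} {p : V}
    (h : ∀ s, b ≤ s → s ≤ roundEnd Γ.Enabled Γ.Acts b →
      (∀ s', b ≤ s' → s' ≤ s → (Γ.conf s').buf p i = (Γ.conf b).buf p i) →
      ∃ x e, Fires (Γ.conf s) (Γ.choice s) p i x e) :
    ∃ s, b ≤ s ∧ s < roundEnd Γ.Enabled Γ.Acts b ∧ Γ.fired s p i ≠ none ∧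
      (Γ.conf s).buf p i = (Γ.conf b).buf p i := by
  by_contra! hno
  obtain ⟨hlt, hround⟩ := roundEnd_spec hfair b
  set T := roundEnd Γ.Enabled Γ.Acts b
  have hconst : ∀ s, b ≤ s → s ≤ T → (Γ.conf s).buf p i = (Γ.conf b).buf p i := by
    intro s hs
    induction s, hs using Nat.le_induction with
    | base => exact fun _ => rfl
    | succ s hs ih =>
      intro hsT
      rw [← ih (by omega)]
      refine Γ.fired_idle s p i ?_
      by_contra hf
      exact hno s hs (by omega) hf (ih (by omega))
  have hen : ∀ s, b ≤ s → s ≤ T → ∃ x e, Fires (Γ.conf s) (Γ.choice s) p i x e :=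
    fun s hs hsT => h s hs hsT fun s' h1 h2 => hconst s' h1 (h2.trans hsT)
  obtain ⟨s, h1, h2, h3⟩ := hround p (Or.inr ⟨i, hen b le_rfl hlt.le⟩)
  rcases h3 with h3 | ⟨_, h3⟩
  -- Simultaneity matters here: otherwise `p` could satisfy the round by acting on other buffers
  -- only.
  · exact hno s h1 h2 (hsim s p h3 ((converged_mono hconv (Nat.zero_le s)).2 p) i
      (hen s h1 h2.le)) (hconst s h1 h2.le)
  · exact h3 (Or.inr ⟨i, hen (s + 1) (by omega) h2⟩)

theorem type_ne_F (hG : G.Connected) (hD : 1 ≤ G.diam) (h0 : NoMessage (Γ.conf 0))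
    (hconv : A.Converged (Γ.conf 0).table) {t i : ℕ} {p : V} {m : M} {r q d : V} {c : MsgType}
    (h1 : 1 ≤ i) (h2 : i ≤ G.diam + 1) (hb : (Γ.conf t).buf p i = some ⟨m, r, q, d, c⟩) :
    c ≠ .F :=
  (onTrack hG hD h0 hconv h1 h2 hb).1

/-- With no child to copy and no failure possible, only delivery can affect a head. -/
theorem head_buf_succ (hG : G.Connected) (hD : 1 ≤ G.diam) (h0 : NoMessage (Γ.conf 0))
    (hconv : A.Converged (Γ.conf 0).table) {s i : ℕ} {p : V} (h1 : 1 ≤ i)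
    (h2 : i ≤ G.diam + 1) (hdel : Γ.fired s p i ≠ some .deliver) (h : Head (Γ.conf s) i p) :
    (Γ.conf (s + 1)).buf p i = (Γ.conf s).buf p i := by
  obtain ⟨m, r, q, d, hb, hn⟩ := h
  cases hf : Γ.fired s p i with
  | none => exact Γ.fired_idle s p i hf
  | some e =>
    cases bufStep hD h0 hf with
    | generate _ _ _ _ _ h => simp [hb] at h
    | reemit _ _ _ _ _ _ _ h => simp [hb] at h
    | forward _ _ _ _ _ _ _ _ _ h => simp [hb] at h
    | deliver _ _ _ he => exact absurd (he ▸ hf) hdel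
    | propagate m2 r2 q2 d2 r' c _ hi h _ hch =>
      rw [hb] at h
      cases h
      exact absurd ⟨_, _, hch⟩ (hn hi)
    | fail m2 r2 q2 d2 _ _ _ _ h =>
      exact absurd rfl (type_ne_F hG hD h0 hconv h1 h2 h)
    | erase m2 r2 q2 d2 c _ h hS =>
      rw [hb] at h
      cases h
      exact absurd rfl hS

/-- A head stays in place; if it acquires a child, the child is new and becomes a head one rank
higher. -/
theorem exists_head_succ (hG : G.Connected) (hD : 1 ≤ G.diam) (h0 : NoMessage (Γ.conf 0))
    (hconv : A.Converged (Γ.conf 0).table) {s i : ℕ} {p : V} (h1 : 1 ≤ i)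
    (h2 : i ≤ G.diam + 1) (hdel : Γ.fired s p i ≠ some .deliver) (h : Head (Γ.conf s) i p) :
    ∃ i' p', i ≤ i' ∧ i' ≤ G.diam + 1 ∧ Head (Γ.conf (s + 1)) i' p' := by
  have hbuf := head_buf_succ hG hD h0 hconv h1 h2 hdel h
  obtain ⟨m, r, q, d, hb, hn⟩ := h
  rw [hb] at hbuf
  by_cases hc : i ≤ G.diam ∧ ∃ r' c, (Γ.conf (s + 1)).buf r (i + 1) = some ⟨m, r', p, d, c⟩
  · obtain ⟨hi, r', c, hr⟩ := hc
    refine ⟨i + 1, r, by omega, by omega, ?_⟩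
    have ht := bufTrans hD h0 s
    rcases ht.type_step (by omega) (by omega) hr with h | ⟨_, h⟩ | ⟨_, h, _⟩ | ⟨_, h, _⟩ |
      ⟨rfl, _, hnone, _⟩
    · exact absurd ⟨_, _, h⟩ (hn hi)
    · exact absurd ⟨_, _, h⟩ (hn hi)
    · omega
    · omega
    · exact (linked hD h0 s).head_of_empty ht (by omega) hnone ⟨_, _, _, _, hr⟩
  · exact ⟨i, p, le_rfl, h2, m, r, q, d, hbuf, fun hi h => hc ⟨hi, h⟩⟩

theorem exists_head_of_le (hG : G.Connected) (hD : 1 ≤ G.diam) (h0 : NoMessage (Γ.conf 0))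
    (hconv : A.Converged (Γ.conf 0).table) {s s' i : ℕ} {p : V} (h1 : 1 ≤ i)
    (h2 : i ≤ G.diam + 1) (hss' : s ≤ s')
    (hdel : ∀ t, s ≤ t → t < s' → ∀ p i, Γ.fired t p i ≠ some .deliver)
    (h : Head (Γ.conf s) i p) :
    ∃ i' p', i ≤ i' ∧ i' ≤ G.diam + 1 ∧ Head (Γ.conf s') i' p' := by
  induction s', hss' using Nat.le_induction with
  | base => exact ⟨i, p, le_rfl, h2, h⟩
  | succ s' hs ih =>
    obtain ⟨i', p', h3, h4, h5⟩ := ih fun t ht ht' => hdel t ht (by omega)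
    obtain ⟨i'', p'', h6, h7⟩ := exists_head_succ hG hD h0 hconv (h1.trans h3) h4
      (hdel s' hs (by omega) _ _) h5
    exact ⟨i'', p'', h3.trans h6, h7⟩

/-- Without delivery, acknowledgments go down by one rank in each round: bounds on the ranks of
the acknowledgments not yet taken over by the preceding copy, and of all of them. -/
theorem ack_rank_le (hD : 1 ≤ G.diam) (h0 : NoMessage (Γ.conf 0))
    (hconv : A.Converged (Γ.conf 0).table) (hfair : Γ.Fair) (hsim : Γ.Simultaneous) {t T : ℕ}
    (hdel : ∀ s, t ≤ s → s < T → ∀ p i, Γ.fired s p i ≠ some .deliver) (n : ℕ) {s : ℕ}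
    (hs : roundBoundary Γ.Enabled Γ.Acts t n ≤ s) (hsT : s ≤ T) {i : ℕ} {p : V} (h1 : 1 ≤ i)
    (h2 : i ≤ G.diam) :
    (Waiting (Γ.conf s) i p → i + n ≤ G.diam) ∧
      (HasType (Γ.conf s) .A (i + 1) p → i + n ≤ G.diam + 1) := by
  induction n generalizing s i p with
  | zero => exact ⟨fun _ => h2, fun _ => by omega⟩
  | succ n ih =>
    set b := roundBoundary Γ.Enabled Γ.Acts t n with hb
    have hmono := roundBoundary_strictMono hfair t
    have hbt : t ≤ b := hmono.monotone (Nat.zero_le n)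
    have hbs : roundEnd Γ.Enabled Γ.Acts b ≤ s := hs
    have hlt := (roundEnd_spec hfair b).1
    -- At this extremal rank no new `A` can arise: it would come from a delivery or from an `A` one
    -- rank above, excluded by induction.
    have hacked : ∀ {s' i p}, 1 ≤ i → i + n = G.diam + 1 → b ≤ s' → s' < s →
        ¬ Acked (Γ.conf s') (Γ.conf (s' + 1)) (i + 1) p := by
      intro s' i p hi hin hbs' hs's ha
      rcases deliver_or_ackPropagated hD h0 ha with h | ⟨_, hi', m, r, q, d, r', _, h⟩
      · exact hdel s' (by omega) (by omega) _ _ h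
      · have := (ih (s := s') (i := i + 1) (p := r) hbs' (by omega) (by omega) hi').2
          ⟨_, _, _, _, h⟩
        omega
    have hacked' : ∀ {s' i p}, 1 ≤ i → i + n = G.diam → b ≤ s' → s' < s →
        ¬ Acked (Γ.conf s') (Γ.conf (s' + 1)) (i + 1) p := by
      intro s' i p hi hin hbs' hs's ha
      rcases deliver_or_ackPropagated hD h0 ha with h | ⟨_, hi', m, r, q, d, r', h', h⟩
      · exact hdel s' (by omega) (by omega) _ _ h
      · have := (ih (s := s') (i := i + 1) (p := r) hbs' (by omega) (by omega) hi').1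
          ⟨_, _, _, _, _, h, h'⟩
        omega
    constructor
    · rintro ⟨m, r, q, d, q', hp, hq⟩
      by_contra hcon
      have hin : i + n = G.diam := by
        have := (ih (s := s) (by omega) hsT h1 h2).1 ⟨m, r, q, d, q', hp, hq⟩
        omega
      -- Backwards in time: since no new `A` arises at this rank, the waiting pair found at time `s`
      -- was there during the whole round. `R7` was thus enabled throughout, so it fired and changed
      -- the buffer.
      have key : ∀ k s', s' + k = s → b ≤ s' →
          (Γ.conf s').buf p (i + 1) = some ⟨m, r, q, d, .A⟩ ∧
            (Γ.conf s').buf q i = some ⟨m, p, q', d, .S⟩ := by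
        intro k
        induction k with
        | zero =>
          rintro s' rfl -
          exact ⟨hp, hq⟩
        | succ k ihk =>
          intro s' hs' hbs'
          obtain ⟨h3, h4⟩ := ihk (s' + 1) (by omega) (by omega)
          have hA : HasType (Γ.conf s') .A (i + 1) p := by
            by_contra hA
            exact hacked' h1 hin hbs' (by omega) ⟨⟨_, _, _, _, h3⟩, hA⟩
          have ht := bufTrans hD h0 s'
          have h5 := ht.type_A_step (by omega) (by omega) h3 hA
          refine ⟨h5, ?_⟩
          obtain ⟨-, q2, c', hq2, rfl | rfl⟩ := (linked hD h0 s').parent h1 h2 h5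
          · exact ht.type_S_step h1 (by omega) h4 ⟨_, _, _, _, hq2⟩
          · rcases (linked hD h0 s').parent_step ht h1 h2 h5 hq2 with h6 | ⟨h6, _⟩
            · rw [h4] at h6
              cases h6
            · cases h6
      have hqd := ((linked hD h0 s).parent h1 h2 hp).1
      obtain ⟨s', h3, h4, h5, -⟩ := exists_fired hfair hsim hconv (b := b) (i := i) (p := q)
        fun s' hs' hs'' _ => by
          obtain ⟨h6, h7⟩ := key (s - s') s' (by omega) hs'
          exact ⟨_, _, .R7 i m p q' d r .A h1 h2 h7 hqd h6 nofun⟩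
      refine buf_succ_ne_of_fired hD h0 h5 ?_
      rw [(key (s - s') s' (by omega) h3).2, (key (s - (s' + 1)) (s' + 1) (by omega) (by omega)).2]
    · rintro ⟨m, r, q, d, hp⟩
      by_contra hcon
      have hin : i + n = G.diam + 1 := by
        have := (ih (s := s) (by omega) hsT h1 h2).2 ⟨m, r, q, d, hp⟩
        omega
      -- Likewise the `A` has been there all round. It is not waiting, so its parent has type `A`,
      -- and it has no child of type `A`; erasure was enabled throughout.
      have key : ∀ k s', s' + k = s → b ≤ s' →
          (Γ.conf s').buf p (i + 1) = some ⟨m, r, q, d, .A⟩ := by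
        intro k
        induction k with
        | zero =>
          rintro s' rfl -
          exact hp
        | succ k ihk =>
          intro s' hs' hbs'
          have h3 := ihk (s' + 1) (by omega) (by omega)
          refine (bufTrans hD h0 s').type_A_step (by omega) (by omega) h3 ?_
          by_contra hA
          exact hacked h1 hin hbs' (by omega) ⟨⟨_, _, _, _, h3⟩, hA⟩
      obtain ⟨s', h3, h4, h5, -⟩ := exists_fired hfair hsim hconv (b := b) (i := i + 1) (p := p)
        fun s' hs' hs'' _ => by
          have h6 := key (s - s') s' (by omega) hs'
          obtain ⟨-, q', c', hq, rfl | rfl⟩ := (linked hD h0 s').parent h1 h2 h6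
          · have := (ih (s := s') hs' (by omega) h1 h2).1 ⟨_, _, _, _, _, h6, hq⟩
            omega
          · refine exists_fires_erase h1 h2 h6 nofun hq fun hi ⟨r', hr⟩ => ?_
            have := (ih (s := s') (i := i + 1) (p := r) hs' (by omega) (by omega) hi).2
              ⟨_, _, _, _, hr⟩
            omega
      refine buf_succ_ne_of_fired hD h0 h5 ?_
      rw [key (s - s') s' (by omega) h3, key (s - (s' + 1)) (s' + 1) (by omega) (by omega)]

/-- When no acknowledgment is left at the ranks from `2` on, caterpillars of type `S` reach
a higher rank in each round without delivery. -/
theorem exists_head_roundEnd (hG : G.Connected) (hD : 1 ≤ G.diam) (h0 : NoMessage (Γ.conf 0))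
    (hconv : A.Converged (Γ.conf 0).table) (hfair : Γ.Fair) (hsim : Γ.Simultaneous) {b : ℕ}
    (hdel : ∀ s, b ≤ s → s < roundEnd Γ.Enabled Γ.Acts b → ∀ p i, Γ.fired s p i ≠ some .deliver)
    (hA : ∀ i p, 1 ≤ i → i ≤ G.diam → ¬ HasType (Γ.conf b) .A (i + 1) p) {i : ℕ} {p : V}
    (h1 : 1 ≤ i) (h2 : i ≤ G.diam + 1) (h : Head (Γ.conf b) i p) :
    ∃ i' p', i + 1 ≤ i' ∧ i' ≤ G.diam + 1 ∧
      Head (Γ.conf (roundEnd Γ.Enabled Γ.Acts b)) i' p' := by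
  set T := roundEnd Γ.Enabled Γ.Acts b with hT
  have hlt : b < T := (roundEnd_spec hfair b).1
  obtain ⟨m, r, q, d, hb, hn⟩ := id h
  by_cases hpd : p = d
  · subst hpd
    obtain ⟨s, h3, h4, h5, h6⟩ := exists_fired hfair hsim hconv (b := b) (i := i) (p := p)
      fun s hs _ h => exists_fires_deliver h1 h2 ((h s hs le_rfl).trans hb)
    rw [hb] at h6
    obtain ⟨e, he⟩ := Option.ne_none_iff_exists'.1 h5
    cases bufStep hD h0 he with
    | generate _ _ _ _ _ h => simp [h6] at h
    | reemit _ _ _ _ _ _ _ h => simp [h6] at h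
    | forward _ _ _ _ _ _ _ _ _ h => simp [h6] at h
    | deliver _ _ _ he' => exact absurd (he' ▸ he) (hdel s h3 h4 p i)
    | propagate _ _ _ _ _ _ _ _ h hp =>
      rw [h6] at h
      cases h
      exact absurd rfl hp
    | fail _ _ _ _ _ _ h hp =>
      rw [h6] at h
      cases h
      exact absurd rfl hp
    | erase _ _ _ _ _ _ h hS =>
      rw [h6] at h
      cases h
      exact absurd rfl hS
  have hiD : i ≤ G.diam := by
    by_contra hi
    have h3 : G.dist p d + i ≤ G.diam + 1 := (onTrack hG hD h0 hconv h1 h2 hb).2.1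
    exact hpd (hG.dist_eq_zero_iff.1 (by omega))
  -- If the target is empty, the head persists until the target is filled, possibly by another
  -- message, which becomes a head. If it is occupied, perhaps by an unrelated message, that message
  -- has type `S` and its chain ends at rank at least i + 1.
  by_cases hr : (Γ.conf b).buf r (i + 1) = none
  · have hhead : ∀ s, b ≤ s → s ≤ T →
        (∀ s', b ≤ s' → s' ≤ s → (Γ.conf s').buf r (i + 1) = (Γ.conf b).buf r (i + 1)) →
        (Γ.conf s).buf p i = some ⟨m, r, q, d, .S⟩ := by
      intro s hs
      induction s, hs using Nat.le_induction with
      | base => exact fun _ _ => hb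
      | succ s hs ih =>
        intro hsT hs'
        have h3 := ih (by omega) fun s' h4 h5 => hs' s' h4 (by omega)
        rw [head_buf_succ hG hD h0 hconv h1 h2 (hdel s hs (by omega) p i)
          ⟨m, r, q, d, h3, fun _ => by simp [hs' s hs (by omega), hr]⟩, h3]
    obtain ⟨s, h3, h4, h5, h6⟩ := exists_fired hfair hsim hconv (b := b) (i := i + 1) (p := r)
      fun s hs hsT h => (linked hD h0 s).exists_fires_forward (Γ.choice_valid s) h1 hiD
        ((h s hs le_rfl).trans hr) (hhead s hs hsT h) hpd
    rw [hr] at h6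
    obtain ⟨e, he⟩ := Option.ne_none_iff_exists'.1 h5
    have hS : HasType (Γ.conf (s + 1)) .S (i + 1) r := by
      cases bufStep hD h0 he with
      | generate _ _ _ _ hi => omega
      | reemit _ _ _ _ _ _ hi => omega
      | forward _ _ _ _ _ _ _ _ _ _ _ _ _ h => exact ⟨_, _, _, _, h⟩
      | deliver _ _ _ _ h => simp [h6] at h
      | propagate _ _ _ _ _ _ _ _ h => simp [h6] at h
      | fail _ _ _ _ _ _ h => simp [h6] at h
      | erase _ _ _ _ _ _ h => simp [h6] at h
    exact exists_head_of_le hG hD h0 hconv (by omega) (by omega) (by omega : s + 1 ≤ T)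
      (fun s' h7 h8 => hdel s' (by omega) h8)
      ((linked hD h0 s).head_of_empty (bufTrans hD h0 s) (by omega) h6 hS)
  · have hall : ∀ i p m r q d c, 1 ≤ i → i ≤ G.diam →
        (Γ.conf b).buf p (i + 1) = some ⟨m, r, q, d, c⟩ → c = .S := by
      intro i p m r q d c h3 h4 h5
      cases c with
      | S => rfl
      | A => exact absurd ⟨_, _, _, _, h5⟩ (hA i p h3 h4)
      | F => exact absurd rfl (type_ne_F hG hD h0 hconv (by omega) (by omega) h5)
    obtain ⟨⟨m', r', q', d', c'⟩, h3⟩ := Option.ne_none_iff_exists'.1 hr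
    obtain rfl := hall _ _ _ _ _ _ _ h1 hiD h3
    obtain ⟨i', p', h4, h5, h6⟩ := exists_head_of_type_S hall (G.diam - i) (by omega) (by omega)
      ⟨_, _, _, _, h3⟩
    obtain ⟨i'', p'', h7, h8⟩ := exists_head_of_le hG hD h0 hconv (by omega) h5 hlt.le hdel h6
    exact ⟨i'', p'', by omega, h8⟩

theorem exists_deliversAt (hG : G.Connected) (h0 : NoMessage (Γ.conf 0))
    (hconv : A.Converged (Γ.conf 0).table) (hfair : Γ.Fair) (hsim : Γ.Simultaneous) {t : ℕ}
    (hcat : HasSCaterpillar (Γ.conf t)) :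
    ∃ s, t ≤ s ∧ s < roundBoundary Γ.Enabled Γ.Acts t (2 * G.diam + 2) ∧ Γ.DeliversAt s := by
  have hD := one_le_diam hG Γ
  by_contra! hno
  have hmono := roundBoundary_strictMono hfair t
  set T := roundBoundary Γ.Enabled Γ.Acts t (2 * G.diam + 2) with hT
  have hdel : ∀ s, t ≤ s → s < T → ∀ p i, Γ.fired s p i ≠ some .deliver :=
    fun s h1 h2 p i h => hno s h1 h2 ⟨p, i, h⟩
  -- The first D + 1 rounds clear the acknowledgments of ranks at least 2; each further round raises
  -- a head, until k = D + 1 demands rank D + 2.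
  have key : ∀ k, k ≤ G.diam + 1 → ∃ i p, k + 1 ≤ i ∧ i ≤ G.diam + 1 ∧
      Head (Γ.conf (roundBoundary Γ.Enabled Γ.Acts t (G.diam + 1 + k))) i p := by
    intro k
    induction k with
    | zero =>
      intro _
      obtain ⟨i, p, h1, h2, h3⟩ := hcat.exists_head (linked hD h0 t)
      have hle : roundBoundary Γ.Enabled Γ.Acts t (G.diam + 1) ≤ T :=
        hmono.monotone (by omega)
      obtain ⟨i', p', h4, h5⟩ := exists_head_of_le hG hD h0 hconv h1 h2
        (hmono.monotone (Nat.zero_le (G.diam + 1)))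
        (fun s h1 h2 => hdel s h1 (h2.trans_le hle)) h3
      exact ⟨i', p', by omega, h5⟩
    | succ k ih =>
      intro hk
      obtain ⟨i, p, h1, h2, h3⟩ := ih (by omega)
      have hle : t ≤ roundBoundary Γ.Enabled Γ.Acts t (G.diam + 1 + k) :=
        hmono.monotone (Nat.zero_le (G.diam + 1 + k))
      have hle' : roundBoundary Γ.Enabled Γ.Acts t (G.diam + 1 + (k + 1)) ≤ T :=
        hmono.monotone (by omega)
      obtain ⟨i', p', h4, h5⟩ := exists_head_roundEnd hG hD h0 hconv hfair hsim
        (fun s h4 h5 => hdel s (hle.trans h4) (h5.trans_le hle')) (fun i p h4 h5 h6 => by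
          have := (ack_rank_le hD h0 hconv hfair hsim hdel (G.diam + 1)
            (hmono.monotone (by omega)) (hmono.monotone (by omega)) h4 h5).2 h6
          omega) (by omega) h2 h3
      exact ⟨i', p', by omega, h5⟩
  obtain ⟨i, p, h1, h2, -⟩ := key (G.diam + 1) le_rfl
  omega

end Progress

end Execution

end SSMFP

theorem mainTheorem6 :
    (∃ C : ℕ, ∀ (V : Type u) [Fintype V] (M : Type v) (G : SimpleGraph V), G.Connected →
      ∀ (A : SSMFP.RoutingAlgorithm.{u, w} G) (RA : ℕ), A.IsStabilizationTime RA →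
      ∀ Γ : SSMFP.Execution A M, Γ.Fair → SSMFP.NoMessage (Γ.conf 0) → Γ.GeneratesSome →
        Γ.amortizedComplexity ≤ (C : ENNReal) * ((max RA G.diam : ℕ) : ENNReal)) ∧
    (∀ (V : Type u) [Fintype V] (M : Type v) (G : SimpleGraph V), G.Connected →
      ∀ (A : SSMFP.RoutingAlgorithm.{u, w} G) (Γ : SSMFP.Execution A M),
        Γ.Fair → Γ.Simultaneous → SSMFP.NoMessage (Γ.conf 0) → A.Converged (Γ.conf 0).table →
        ∀ t, SSMFP.HasSCaterpillar (Γ.conf t) →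
          ∃ s, t ≤ s ∧ s < SSMFP.roundBoundary Γ.Enabled Γ.Acts t (3 * G.diam + 1) ∧
            Γ.DeliversAt s) := by
  refine ⟨⟨25, fun V _ M G hG A RA hRA Γ hfair h0 hgen =>
    SSMFP.Execution.amortizedComplexity_le hG h0 hfair hgen hRA.1⟩,
    fun V _ M G hG A Γ hfair hsim h0 hconv t hcat => ?_⟩
  obtain ⟨s, h1, h2, h3⟩ := SSMFP.Execution.exists_deliversAt hG h0 hconv hfair hsim hcat
  -- D ≥ 1 is what turns the bound 2D + 2 into 3D + 1.
  have hD := SSMFP.Execution.one_le_diam hG Γ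
  exact ⟨s, h1, h2.trans_le ((SSMFP.roundBoundary_strictMono hfair t).monotone (by omega)), h3⟩
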